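/- Let $G$ be a hyperbolic group and let $\Gamma=\Gamma(G,S)$ be its Cayley graph with respect to a finite symmetric generating set $S$ (so $\Gamma$ is a Gromov-hyperbolic graph), with vertex set $G$, edge set $E$ and graph metric $d$. For a sequence $(x_n)$ in $G$ and a point $\xi$ of the Gromov boundary $\partial G$ (the set of equivalence classes of sequences with $\langle x_n,x_m\rangle_1\to\infty$ as $m,n\to\infty$, where $(x_n)\sim(x_n')$ if $\langle x_n,x_n'\rangle_1\to\infty$), write $x_n\to\xi$ if $(x_n)$ belongs to the class $\xi$. Let $\rho$ be a probability measure on $[0,\infty)$ without atoms such that $\int e^{ax^2}\,d\rho(x)<\infty$ for some $a>0$, and let $\mathbb P=\rho^{\otimes E}$ on $\Omega=[0,\infty)^E$. For $\omega\in\Omega$ the $\omega$-length of an edge path is the sum of the weights $\omega(e)$ of its edges, $d_\omega(x,y)$ is the infimum of the $\omega$-lengths of the edge paths from $x$ to $y$, and an $\omega$-geodesic is an edge path from $x$ to $y$ whose $\omega$-length is $d_\omega(x,y)$. An $\omega$-geodesic ray from $o$ in direction $\xi$ is a semi-infinite edge path $\gamma=(\gamma_0,\gamma_1,\dots)$ in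 $\Gamma$ with $\gamma_0=o$, all of whose finite subpaths are $\omega$-geodesics, such that $\gamma_n\to\xi$ and $y_n\to\xi$ for every sequence $(y_n)$ of vertices of $\gamma$ with $d(y_n,1)\to\infty$. Then for every $\xi\in\partial G$: 1. for every $o\in G$, for $\mathbb P$-almost every $\omega$ there exists a unique $\omega$-geodesic ray from $o$ in direction $\xi$; 2. for $\mathbb P$-almost every $\omega$, for all $o_1,o_2\in G$, any $\omega$-geodesic ray $\gamma$ from $o_1$ in direction $\xi$ and any $\omega$-geodesic ray $\gamma'$ from $o_2$ in direction $\xi$ coalesce: there are $m,n\ge 0$ with $\gamma_{m+k}=\gamma'_{n+k}$ for all $k\ge 0$. -/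

import Mathlib

open MeasureTheory Filter
open scoped NNReal

namespace FPP

/-! Word metric, Gromov hyperbolicity and the Gromov boundary of a graph. -/

/-- A path is a (word) geodesic if its number of edges is the graph distance of its endpoints. -/
def IsWordGeodesic {V : Type*} {Γ : SimpleGraph V} {x y : V} (p : Γ.Walk x y) : Prop :=
  p.length = Γ.dist x y

/-- All geodesic triangles with vertices `x, y, z` in the vertex set are `δ`-slim. -/
def IsDeltaHyperbolic {V : Type*} (Γ : SimpleGraph V) (δ : ℝ) : Prop :=
  ∀ (x y z : V) (p : Γ.Walk x y) (q : Γ.Walk x z) (r : Γ.Walk y z),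
    IsWordGeodesic p → IsWordGeodesic q → IsWordGeodesic r →
      ∀ v ∈ p.support, ∃ w, (w ∈ q.support ∨ w ∈ r.support) ∧ (Γ.dist v w : ℝ) ≤ δ

/-- Gromov hyperbolicity of a graph. -/
def IsHyperbolic {V : Type*} (Γ : SimpleGraph V) : Prop :=
  ∃ δ : ℝ, 0 ≤ δ ∧ IsDeltaHyperbolic Γ δ

/-- The Gromov product of `x` and `y` based at `o`, in the graph metric. -/
noncomputable def gromovProduct {V : Type*} (Γ : SimpleGraph V) (o x y : V) : ℝ :=
  ((Γ.dist x o : ℝ) + (Γ.dist y o : ℝ) - (Γ.dist x y : ℝ)) / 2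

/-- The sequence `x` satisfies `⟨x_n, x_m⟩_o → ∞` as `n, m → ∞`. -/
def ConvergesToInfinity {V : Type*} (Γ : SimpleGraph V) (o : V) (x : ℕ → V) : Prop :=
  Tendsto (fun nm : ℕ × ℕ => gromovProduct Γ o (x nm.1) (x nm.2)) (atTop ×ˢ atTop) atTop

/-- Two sequences are equivalent if `⟨x_n, y_n⟩_o → ∞` as `n → ∞`. -/
def SeqEquiv {V : Type*} (Γ : SimpleGraph V) (o : V) (x y : ℕ → V) : Prop :=
  Tendsto (fun n : ℕ => gromovProduct Γ o (x n) (y n)) atTop atTop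

/-- The Gromov boundary: the set of equivalence classes of sequences converging to infinity.
A boundary point is literally such a class, that is, a set of sequences. -/
def Boundary {V : Type*} (Γ : SimpleGraph V) (o : V) : Type _ :=
  {ξ : Set (ℕ → V) // ∃ x, ConvergesToInfinity Γ o x ∧
    ξ = {y | ConvergesToInfinity Γ o y ∧ SeqEquiv Γ o x y}}

/-- `x_n → ξ`: the sequence `x` belongs to the class `ξ`. -/
def ConvergesTo {V : Type*} {Γ : SimpleGraph V} {o : V} (x : ℕ → V) (ξ : Boundary Γ o) : Prop :=
  x ∈ ξ.1

/-! First passage percolation on a graph. -/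

/-- The configuration space `[0, ∞)^E`. -/
abbrev Config {V : Type*} (Γ : SimpleGraph V) : Type _ := Γ.edgeSet → ℝ≥0

/-- The law of i.i.d. edge weights with common law `ρ`: the product measure on `[0, ∞)^E`. -/
noncomputable def configMeasure {V : Type*} (Γ : SimpleGraph V) (ρ : Measure ℝ≥0)
    [IsProbabilityMeasure ρ] : Measure (Config Γ) :=
  Measure.infinitePi (fun _ : Γ.edgeSet => ρ)

/-- The `ω`-length of an edge path: the sum of the weights of its edges. -/
def omegaLength {V : Type*} {Γ : SimpleGraph V} (ω : Config Γ) {x y : V} (p : Γ.Walk x y) : ℝ≥0 :=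
  (p.darts.map fun e => ω ⟨e.edge, e.edge_mem⟩).sum

/-- The first passage time `d_ω(x, y)`, the infimum of the `ω`-lengths of the paths from
`x` to `y`. -/
noncomputable def passageTime {V : Type*} {Γ : SimpleGraph V} (ω : Config Γ) (x y : V) : ℝ≥0 :=
  ⨅ p : Γ.Walk x y, omegaLength ω p

/-- An `ω`-geodesic is a path that realizes `d_ω`. -/
def IsOmegaGeodesic {V : Type*} {Γ : SimpleGraph V} (ω : Config Γ) {x y : V}
    (p : Γ.Walk x y) : Prop :=
  omegaLength ω p = passageTime ω x y

/-- The subpath `γ i, γ (i + 1), …, γ (i + n)` of a semi-infinite path `γ`. -/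
def segment {V : Type*} {Γ : SimpleGraph V} (γ : ℕ → V) (h : ∀ k, Γ.Adj (γ k) (γ (k + 1)))
    (i : ℕ) : (n : ℕ) → Γ.Walk (γ i) (γ (i + n))
  | 0 => SimpleGraph.Walk.nil
  | n + 1 => (segment γ h i n).concat (h (i + n))

/-- `γ` is an `ω`-geodesic ray: a semi-infinite path all of whose finite subpaths are
`ω`-geodesics. -/
def IsOmegaGeodesicRay {V : Type*} (Γ : SimpleGraph V) (ω : Config Γ) (γ : ℕ → V) : Prop :=
  ∃ h : ∀ k, Γ.Adj (γ k) (γ (k + 1)), ∀ i n, IsOmegaGeodesic ω (segment γ h i n)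

/-- `γ` has direction `ξ`: `γ n → ξ`, and every sequence of points of `γ` whose distance to the
base point tends to infinity converges to `ξ`. -/
def HasDirection {V : Type*} {Γ : SimpleGraph V} {o : V} (γ : ℕ → V) (ξ : Boundary Γ o) : Prop :=
  ConvergesTo γ ξ ∧
    ∀ y : ℕ → V, (∀ n, y n ∈ Set.range γ) →
      Tendsto (fun n => Γ.dist (y n) o) atTop atTop → ConvergesTo y ξ

/-- `γ` is an `ω`-geodesic ray started at `x` in direction `ξ`. -/
def IsOmegaRayFromTo {V : Type*} {Γ : SimpleGraph V} {o : V} (ω : Config Γ) (x : V)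
    (ξ : Boundary Γ o) (γ : ℕ → V) : Prop :=
  IsOmegaGeodesicRay Γ ω γ ∧ γ 0 = x ∧ HasDirection γ ξ

/-- Two semi-infinite paths coalesce if they coincide from some vertex of each on. -/
def Coalesce {V : Type*} (γ₁ γ₂ : ℕ → V) : Prop :=
  ∃ m n : ℕ, ∀ k : ℕ, γ₁ (m + k) = γ₂ (n + k)

end FPP

/-!
Fix a sequence `x` in the class of `ξ`. The proof exhibits, almost surely, infinitely many *cut
vertices* on the way to `ξ`: vertices `v i` at increasing distances, through which every
`ω`-geodesic from a vertex behind `v i` to a vertex ahead of `v i`, towards `ξ`, has to pass.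
Since `ρ` has no atoms, almost surely all weights are positive and two distinct paths with the same
endpoints have distinct lengths (`ae_weight_pos`, `ae_injective_omegaLength`), so that
`ω`-geodesics are unique. The rest is then deterministic (`IsMarkerSequence.exists_ray`,
`IsMarkerSequence.ray_unique`, `IsMarkerSequence.coalesce`): the `ω`-geodesics from `o` to the cut
vertices extend one another, and their union is a ray, which tends to `ξ` because it cannot return
to the region behind a cut vertex that it has passed. Conversely every ray in direction `ξ` passes
through all but finitely many of the cut vertices, so rays from the same vertex are equal, and rays
from different vertices coalesce at a common cut vertex.

Cut vertices come from *corridors*. Choose two disjoint intervals `[a₀, a₁]` and `[b₀, b₁]`, with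
`0 < a₀` and `a₁ < b₀`, both charged by `ρ`. There is a corridor at the midpoint `p` of a word
geodesic of length `2 * N` if, in the ball of radius `M` around `p`, the edges of this geodesic
have weights in `[a₀, a₁]` and all the others have weights in `[b₀, b₁]`. An `ω`-geodesic which
comes close to both ends of the corridor saves more by following it than it could pay for leaving
it, so it passes through `p` (`HasCorridor.mem_support`). That it comes close to both ends is a
stability property of `ω`-geodesics (`HasLinearGrowth.exists_mem_support_dist_le`): if `ω`-lengths
are comparable to numbers of edges, up to an error growing linearly with the distance to `p`, then
an `ω`-geodesic whose endpoints are joined by a word geodesic passing near `p` passes within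
distance `H` of `p` itself, as a detour around a ball of radius `h` is exponentially long in `h`.
Here `H` is of order `log N`, which lets the scales `N` and `M` be chosen
(`exists_corridor_scale`).

The comparison of lengths with numbers of edges holds around a given vertex with probability close
to one, uniformly in the weights inside a ball, by a Chernoff bound summed over all paths
(`IsGrowthRate.measure_growthFailure_le`). The corridor and the comparison, the latter truncated to
a large ball and tested with the extreme weights `a₀` and `b₁` inside the small one, depend on
disjoint sets of edges; so they happen together with a probability bounded below, independently at
vertices far apart. By the Borel–Cantelli lemmas, corridors with linear growth around them occur
infinitely often (`ae_frequently_hasCorridor`).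
-/

namespace FPP

/-! ### Slim triangles in the word metric -/

/-- The vertex `w` lies on some word geodesic from `x` to `y`. -/
def Between {V : Type*} (Γ : SimpleGraph V) (x w y : V) : Prop :=
  Γ.dist x w + Γ.dist w y = Γ.dist x y

/-- Slimness of geodesic triangles, expressed through distances only, with an integer constant:
a vertex on a side is within `δ` of a vertex on one of the other two sides. -/
def IsSlim {V : Type*} (Γ : SimpleGraph V) (δ : ℕ) : Prop :=
  ∀ x y z v : V, Between Γ x v y →
    ∃ w, Γ.dist v w ≤ δ ∧ (Between Γ x w z ∨ Between Γ y w z)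

/-- The vertices `g 0, …, g n` are the successive vertices of a word geodesic. -/
def IsGeodesicSegment {V : Type*} (Γ : SimpleGraph V) (n : ℕ) (g : ℕ → V) : Prop :=
  ∀ i j, i ≤ j → j ≤ n → Γ.dist (g i) (g j) + i = j

section Geometry

variable {V : Type*} {Γ : SimpleGraph V}

theorem dist_add_dist_eq_of_mem_support {x y w : V} (hc : Γ.Connected) (p : Γ.Walk x y)
    (hp : IsWordGeodesic p) (hw : w ∈ p.support) : Between Γ x w y := by
  classical
  have h1 := SimpleGraph.dist_le (p.takeUntil w hw)
  have h2 := SimpleGraph.dist_le (p.dropUntil w hw)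
  have h3 := congrArg SimpleGraph.Walk.length (p.take_spec hw)
  rw [SimpleGraph.Walk.length_append] at h3
  have h4 := hc.dist_triangle (u := x) (v := w) (w := y)
  unfold IsWordGeodesic at hp
  unfold Between
  omega

theorem exists_isWordGeodesic (hc : Γ.Connected) (x y : V) :
    ∃ p : Γ.Walk x y, IsWordGeodesic p :=
  hc.exists_walk_length_eq_dist x y

theorem Between.exists_walk {x w y : V} (hc : Γ.Connected) (h : Between Γ x w y) :
    ∃ p : Γ.Walk x y, IsWordGeodesic p ∧ w ∈ p.support := by
  obtain ⟨p, hp⟩ := exists_isWordGeodesic hc x w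
  obtain ⟨q, hq⟩ := exists_isWordGeodesic hc w y
  refine ⟨p.append q, ?_, ?_⟩
  · unfold IsWordGeodesic Between at *
    rw [SimpleGraph.Walk.length_append]
    omega
  · rw [SimpleGraph.Walk.mem_support_append_iff]
    exact Or.inl p.end_mem_support

theorem IsDeltaHyperbolic.isSlim {δ : ℝ} (hc : Γ.Connected) (h : IsDeltaHyperbolic Γ δ) :
    IsSlim Γ (⌈δ⌉₊ + 1) := by
  intro x y z v hv
  obtain ⟨p, hp, hvp⟩ := hv.exists_walk hc
  obtain ⟨q, hq⟩ := exists_isWordGeodesic hc x z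
  obtain ⟨r, hr⟩ := exists_isWordGeodesic hc y z
  obtain ⟨w, hw, hd⟩ := h x y z p q r hp hq hr v hvp
  refine ⟨w, ?_, ?_⟩
  · have : (Γ.dist v w : ℝ) ≤ (⌈δ⌉₊ : ℝ) := hd.trans (Nat.le_ceil δ)
    have : Γ.dist v w ≤ ⌈δ⌉₊ := by exact_mod_cast this
    omega
  · exact hw.imp (dist_add_dist_eq_of_mem_support hc q hq)
      (dist_add_dist_eq_of_mem_support hc r hr)

theorem Between.symm {x w y : V} (h : Between Γ x w y) : Between Γ y w x := by
  unfold Between at *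
  rw [Γ.dist_comm (u := y), Γ.dist_comm (u := w) (v := x), Γ.dist_comm (u := y) (v := x)]
  omega

theorem dist_getVert_le {x y : V} (p : Γ.Walk x y) {i j : ℕ} (hij : i ≤ j) :
    Γ.dist (p.getVert i) (p.getVert j) ≤ j - i := by
  have h := SimpleGraph.dist_le ((p.drop i).take (j - i))
  rw [SimpleGraph.Walk.take_length, SimpleGraph.Walk.drop_getVert, Nat.add_sub_cancel' hij] at h
  omega

theorem exists_isGeodesicSegment (hc : Γ.Connected) (x y : V) :
    ∃ g : ℕ → V, IsGeodesicSegment Γ (Γ.dist x y) g ∧ g 0 = x ∧ g (Γ.dist x y) = y := by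
  obtain ⟨p, hp⟩ := exists_isWordGeodesic hc x y
  have hp' : p.length = Γ.dist x y := hp
  have hy : p.getVert (Γ.dist x y) = y := by rw [← hp']; exact p.getVert_length
  refine ⟨p.getVert, fun i j hij hj => ?_, p.getVert_zero, hy⟩
  have h1 := dist_getVert_le p (Nat.zero_le i)
  have h2 := dist_getVert_le p hij
  have h3 := dist_getVert_le p hj
  rw [hy] at h3
  rw [p.getVert_zero] at h1
  have h4 := hc.dist_triangle (u := x) (v := p.getVert i) (w := y)
  have h5 := hc.dist_triangle (u := p.getVert i) (v := p.getVert j) (w := y)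
  omega

theorem IsGeodesicSegment.dist_eq {n : ℕ} {g : ℕ → V} (h : IsGeodesicSegment Γ n g) {i j : ℕ}
    (hi : i ≤ n) (hj : j ≤ n) : (Γ.dist (g i) (g j) : ℤ) = |(i : ℤ) - j| := by
  rcases le_total i j with hij | hij
  · have := h i j hij hj
    rw [abs_of_nonpos (by omega)]; omega
  · have := h j i hij hi
    rw [SimpleGraph.dist_comm, abs_of_nonneg (by omega)]; omega

theorem IsGeodesicSegment.between {n : ℕ} {g : ℕ → V} (h : IsGeodesicSegment Γ n g) {i j k : ℕ}
    (hij : i ≤ j) (hjk : j ≤ k) (hk : k ≤ n) : Between Γ (g i) (g j) (g k) := by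
  have h1 := h i j hij (hjk.trans hk)
  have h2 := h j k hjk hk
  have h3 := h i k (hij.trans hjk) hk
  unfold Between
  omega

theorem Between.exists_isGeodesicSegment {x w y : V} (hc : Γ.Connected) (h : Between Γ x w y) :
    ∃ g : ℕ → V, IsGeodesicSegment Γ (Γ.dist x y) g ∧ g 0 = x ∧ g (Γ.dist x y) = y ∧
      g (Γ.dist x w) = w := by
  obtain ⟨g, hg, hg0, hg1⟩ := FPP.exists_isGeodesicSegment hc x w
  obtain ⟨g', hg', hg0', hg1'⟩ := FPP.exists_isGeodesicSegment hc w y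
  unfold Between at h
  have key : ∀ i, i ≤ Γ.dist x w → Γ.dist x (g i) = i := fun i hi => by
    have := hg 0 i (Nat.zero_le _) hi
    rw [hg0] at this
    omega
  refine ⟨fun i => if i ≤ Γ.dist x w then g i else g' (i - Γ.dist x w), ?_, by simp [hg0], ?_,
    by simp [hg1]⟩
  · intro i j hij hj
    by_cases h1 : j ≤ Γ.dist x w
    · simp only [h1, hij.trans h1, if_true]
      exact hg i j hij h1
    · by_cases h2 : i ≤ Γ.dist x w
      · simp only [h1, h2, if_true, if_false]
        have e1 := key i h2
        have e2 := hg i _ h2 le_rfl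
        have e3 := hg' 0 (j - Γ.dist x w) (Nat.zero_le _) (by omega)
        have e4 := hg' (j - Γ.dist x w) _ (by omega) le_rfl
        rw [hg1] at e2
        rw [hg0'] at e3
        rw [hg1'] at e4
        have t1 := hc.dist_triangle (u := g i) (v := w) (w := g' (j - Γ.dist x w))
        have t2 := hc.dist_triangle (u := x) (v := g i) (w := y)
        have t3 := hc.dist_triangle (u := g i) (v := g' (j - Γ.dist x w)) (w := y)
        omega
      · simp only [h1, h2, if_false]
        have := hg' (i - Γ.dist x w) (j - Γ.dist x w) (by omega) (by omega)
        omega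
  · by_cases h0 : Γ.dist x y ≤ Γ.dist x w
    · simp only [h0, if_true]
      have e : Γ.dist w y = 0 := by omega
      have : Γ.dist x y = Γ.dist x w := by omega
      rw [this, hg1]
      exact hc.dist_eq_zero_iff.1 e
    · simp only [h0, if_false]
      have : Γ.dist x y - Γ.dist x w = Γ.dist w y := by omega
      rw [this, hg1']

/-- Exponential divergence: a path with at most `2 ^ m` edges comes within `m * δ` of every vertex
of a word geodesic with the same endpoints. The proof cuts the path in two halves. -/
theorem IsSlim.exists_mem_support_dist_le {δ : ℕ} (hc : Γ.Connected) (h : IsSlim Γ δ) (m : ℕ) :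
    ∀ {x y : V} (p : Γ.Walk x y) {v : V}, Between Γ x v y → p.length ≤ 2 ^ m →
      ∃ w ∈ p.support, Γ.dist v w ≤ m * δ := by
  induction m with
  | zero =>
    intro x y p v hv hp
    have hd := SimpleGraph.dist_le p
    unfold Between at hv
    rw [pow_zero] at hp
    have : Γ.dist x v = 0 ∨ Γ.dist v y = 0 := by omega
    rcases this with h0 | h0
    · exact ⟨x, p.start_mem_support, by rw [SimpleGraph.dist_comm]; omega⟩
    · exact ⟨y, p.end_mem_support, by omega⟩
  | succ m ih =>
    intro x y p v hv hp
    obtain ⟨w, hvw, hw⟩ := h x y (p.getVert (2 ^ m)) v hv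
    have key : ∃ u ∈ p.support, Γ.dist w u ≤ m * δ := by
      rcases hw with hw | hw
      · obtain ⟨u, hu, hd⟩ := ih (p.take (2 ^ m)) hw (by simp)
        refine ⟨u, ?_, hd⟩
        rw [SimpleGraph.Walk.support_take] at hu
        exact List.mem_of_mem_take hu
      · obtain ⟨u, hu, hd⟩ := ih (p.drop (2 ^ m)) hw.symm (by
          rw [SimpleGraph.Walk.drop_length]; rw [pow_succ] at hp; omega)
        refine ⟨u, ?_, hd⟩
        obtain ⟨i, hi, -⟩ := SimpleGraph.Walk.mem_support_iff_exists_getVert.1 hu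
        rw [SimpleGraph.Walk.drop_getVert] at hi
        rw [← hi]
        exact p.getVert_mem_support _
    obtain ⟨u, hu, hd⟩ := key
    refine ⟨u, hu, ?_⟩
    have := hc.dist_triangle (u := v) (v := w) (w := u)
    rw [Nat.succ_mul]
    omega

/-! ### Gromov products -/

theorem gromovProduct_comm (o x y : V) : gromovProduct Γ o x y = gromovProduct Γ o y x := by
  unfold gromovProduct
  rw [Γ.dist_comm (u := x) (v := y)]
  ring

theorem gromovProduct_le_dist (hc : Γ.Connected) (o x y : V) :
    gromovProduct Γ o x y ≤ Γ.dist x o := by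
  have h : (Γ.dist y o : ℝ) ≤ Γ.dist y x + Γ.dist x o := by
    exact_mod_cast hc.dist_triangle
  rw [Γ.dist_comm (u := y) (v := x)] at h
  unfold gromovProduct
  linarith

/-- A word geodesic from `x` to `y` stays at distance at least `⟨x, y⟩_o` from `o`. -/
theorem Between.gromovProduct_le (hc : Γ.Connected) {o x w y : V} (h : Between Γ x w y) :
    gromovProduct Γ o x y ≤ Γ.dist o w := by
  have h1 : (Γ.dist x o : ℝ) ≤ Γ.dist x w + Γ.dist w o := by exact_mod_cast hc.dist_triangle
  have h2 : (Γ.dist y o : ℝ) ≤ Γ.dist y w + Γ.dist w o := by exact_mod_cast hc.dist_triangle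
  have h3 : (Γ.dist x w : ℝ) + Γ.dist w y = Γ.dist x y := by exact_mod_cast h
  rw [Γ.dist_comm (u := y) (v := w)] at h2
  rw [Γ.dist_comm (u := o) (v := w)]
  unfold gromovProduct
  linarith

/-- If points of the geodesics `[o, x]` and `[o, z]` are within `d` of each other, then `⟨x, z⟩_o`
is at least their distance to `o`, up to `d`. -/
theorem le_gromovProduct_of_between (hc : Γ.Connected) {o x z a b : V} (ha : Between Γ o a x)
    (hb : Between Γ o b z) {d : ℕ} (hd : Γ.dist a b ≤ d) :
    (Γ.dist o b : ℝ) - d ≤ gromovProduct Γ o x z := by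
  have h1 : (Γ.dist o a : ℝ) + Γ.dist a x = Γ.dist o x := by exact_mod_cast ha
  have h2 : (Γ.dist o b : ℝ) + Γ.dist b z = Γ.dist o z := by exact_mod_cast hb
  have h3 : (Γ.dist x z : ℝ) ≤ Γ.dist x a + Γ.dist a z := by exact_mod_cast hc.dist_triangle
  have h4 : (Γ.dist a z : ℝ) ≤ Γ.dist a b + Γ.dist b z := by exact_mod_cast hc.dist_triangle
  have h5 : (Γ.dist o b : ℝ) ≤ Γ.dist o a + Γ.dist a b := by exact_mod_cast hc.dist_triangle
  have h6 : (Γ.dist a b : ℝ) ≤ d := by exact_mod_cast hd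
  rw [Γ.dist_comm (u := o) (v := x), Γ.dist_comm (u := a) (v := x)] at h1
  rw [Γ.dist_comm (u := o) (v := z)] at h2
  unfold gromovProduct
  linarith

/-- The four-point inequality for Gromov products. -/
theorem IsSlim.min_gromovProduct_le {δ : ℕ} (hc : Γ.Connected) (h : IsSlim Γ δ) (o x y z : V) :
    min (gromovProduct Γ o x y) (gromovProduct Γ o y z) - (4 * δ + 2) ≤ gromovProduct Γ o x z := by
  set μ := min (gromovProduct Γ o x y) (gromovProduct Γ o y z) with hμ
  have hx : μ ≤ gromovProduct Γ o x y := min_le_left _ _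
  have hz : μ ≤ gromovProduct Γ o y z := min_le_right _ _
  have hnn : ∀ a b : V, 0 ≤ gromovProduct Γ o a b := fun a b => by
    have h1 : (Γ.dist a b : ℝ) ≤ Γ.dist a o + Γ.dist o b := by exact_mod_cast hc.dist_triangle
    rw [Γ.dist_comm (u := o) (v := b)] at h1
    unfold gromovProduct
    linarith
  by_cases hμ0 : μ - (δ + 1) < 0
  · have := hnn x z
    have : (0 : ℝ) ≤ δ := Nat.cast_nonneg _
    linarith
  push Not at hμ0
  -- The vertex `a` of `[o, y]` at distance `t` from `o`, slightly less than both products.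
  obtain ⟨t, ht1, ht2⟩ : ∃ t : ℕ, (t : ℝ) + δ < μ ∧ μ - (δ + 2) ≤ t := by
    refine ⟨⌊μ - (δ + 1)⌋₊, ?_, ?_⟩
    · have := Nat.floor_le hμ0
      linarith
    · have := Nat.lt_floor_add_one (μ - (δ + 1))
      linarith
  have hty : t ≤ Γ.dist o y := by
    have h1 := gromovProduct_le_dist (Γ := Γ) hc o y z
    rw [Γ.dist_comm] at h1
    have h3 : (0 : ℝ) ≤ δ := Nat.cast_nonneg _
    have : (t : ℝ) ≤ Γ.dist o y := by linarith
    exact_mod_cast this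
  obtain ⟨g, hg, hg0, hg1⟩ := exists_isGeodesicSegment hc o y
  have hab : Between Γ o (g t) y := by
    have := hg.between (Nat.zero_le t) hty le_rfl
    rwa [hg0, hg1] at this
  have hda : Γ.dist o (g t) = t := by
    have := hg 0 t (Nat.zero_le t) hty
    rw [hg0] at this
    omega
  have side : ∀ u : V, μ ≤ gromovProduct Γ o y u → ∃ w, Γ.dist (g t) w ≤ δ ∧ Between Γ o w u := by
    intro u hu
    obtain ⟨w, hw, hw' | hw'⟩ := h o y u (g t) hab
    · exact ⟨w, hw, hw'⟩
    · exfalso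
      have h1 := hw'.gromovProduct_le (o := o) hc
      have h2 : (Γ.dist o w : ℝ) ≤ Γ.dist o (g t) + Γ.dist (g t) w := by
        exact_mod_cast hc.dist_triangle
      have h3 : (Γ.dist (g t) w : ℝ) ≤ δ := by exact_mod_cast hw
      rw [hda] at h2
      linarith
  obtain ⟨a, ha, ha'⟩ := side x (by rwa [gromovProduct_comm])
  obtain ⟨b, hb, hb'⟩ := side z hz
  have hd : Γ.dist a b ≤ 2 * δ := by
    have := hc.dist_triangle (u := a) (v := g t) (w := b)
    rw [Γ.dist_comm (u := a) (v := g t)] at this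
    omega
  have h1 := le_gromovProduct_of_between hc ha' hb' hd
  have h2 : (Γ.dist o (g t) : ℝ) ≤ Γ.dist o b + Γ.dist b (g t) := by
    exact_mod_cast hc.dist_triangle
  rw [hda, Γ.dist_comm (u := b)] at h2
  have h3 : (Γ.dist (g t) b : ℝ) ≤ δ := by exact_mod_cast hb
  push_cast at h1
  linarith

/-- If `⟨x, z⟩_o` is well below `t` and `⟨y, z⟩_o` is well above `t`, then geodesics from `x` to `y`
pass near the vertex at distance `t` from `o` on `[o, z]`. -/
theorem IsSlim.exists_between_dist_le {δ : ℕ} (hc : Γ.Connected) (h : IsSlim Γ δ)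
    {o x y z q : V} (hq : Between Γ o q z) (hx : gromovProduct Γ o x z < Γ.dist o q - 2 * δ)
    (hy : Γ.dist o q + δ < gromovProduct Γ o y z) :
    ∃ w, Γ.dist q w ≤ 2 * δ ∧ Between Γ x w y := by
  obtain ⟨a, ha, ha' | ha'⟩ := h o z y q hq
  · obtain ⟨b, hb, hb' | hb'⟩ := h o y x a ha'
    · exfalso
      have hd : Γ.dist b q ≤ 2 * δ := by
        have := hc.dist_triangle (u := b) (v := a) (w := q)
        rw [Γ.dist_comm (u := b) (v := a), Γ.dist_comm (u := a) (v := q)] at this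
        omega
      have := le_gromovProduct_of_between hc hb' hq hd
      push_cast at this
      linarith
    · refine ⟨b, ?_, hb'.symm⟩
      have := hc.dist_triangle (u := q) (v := a) (w := b)
      omega
  · exfalso
    have h1 := ha'.gromovProduct_le (o := o) hc
    rw [gromovProduct_comm] at h1
    have h2 : (Γ.dist o a : ℝ) ≤ Γ.dist o q + Γ.dist q a := by exact_mod_cast hc.dist_triangle
    have h3 : (Γ.dist q a : ℝ) ≤ δ := by exact_mod_cast ha
    linarith

end Geometry

/-! ### Lengths of paths and passage times -/

section PassageTime

variable {V : Type*} {Γ : SimpleGraph V} {ω : Config Γ}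

@[simp]
theorem omegaLength_nil {x : V} : omegaLength ω (SimpleGraph.Walk.nil : Γ.Walk x x) = 0 := by
  simp [omegaLength]

theorem omegaLength_cons {x y z : V} (h : Γ.Adj x y) (p : Γ.Walk y z) :
    omegaLength ω (SimpleGraph.Walk.cons h p) = ω ⟨s(x, y), h⟩ + omegaLength ω p := by
  simp [omegaLength, SimpleGraph.Dart.edge]

theorem omegaLength_append {x y z : V} (p : Γ.Walk x y) (q : Γ.Walk y z) :
    omegaLength ω (p.append q) = omegaLength ω p + omegaLength ω q := by
  simp [omegaLength, SimpleGraph.Walk.darts_append]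

theorem omegaLength_reverse {x y : V} (p : Γ.Walk x y) :
    omegaLength ω p.reverse = omegaLength ω p := by
  induction p with
  | nil => simp
  | cons h p ih =>
    rw [SimpleGraph.Walk.reverse_cons, omegaLength_append, ih, omegaLength_cons, omegaLength_cons,
      omegaLength_nil, add_zero, add_comm]
    congr 2
    exact Subtype.ext Sym2.eq_swap

theorem omegaLength_bypass_le [DecidableEq V] {x y : V} (p : Γ.Walk x y) :
    omegaLength ω p.bypass ≤ omegaLength ω p :=
  ((p.darts_bypass_sublist_darts).map _).sum_le_sum (fun _ _ => zero_le)

theorem passageTime_le {x y : V} (p : Γ.Walk x y) : passageTime ω x y ≤ omegaLength ω p :=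
  ciInf_le (OrderBot.bddBelow _) p

theorem le_passageTime (hc : Γ.Connected) {x y : V} {t : ℝ≥0}
    (h : ∀ p : Γ.Walk x y, t ≤ omegaLength ω p) : t ≤ passageTime ω x y := by
  have : Nonempty (Γ.Walk x y) := hc x y
  exact le_ciInf h

theorem passageTime_triangle (hc : Γ.Connected) (x y z : V) :
    passageTime ω x z ≤ passageTime ω x y + passageTime ω y z := by
  have : Nonempty (Γ.Walk x y) := hc x y
  have : Nonempty (Γ.Walk y z) := hc y z
  exact NNReal.le_iInf_add_iInf fun p q => by
    rw [← omegaLength_append]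
    exact passageTime_le _

theorem IsOmegaGeodesic.reverse (hc : Γ.Connected) {x y : V} {p : Γ.Walk x y}
    (hp : IsOmegaGeodesic ω p) : IsOmegaGeodesic ω p.reverse := by
  unfold IsOmegaGeodesic at *
  refine le_antisymm (le_passageTime hc fun q => ?_) (passageTime_le _)
  rw [omegaLength_reverse, hp, ← omegaLength_reverse q]
  exact passageTime_le _

theorem IsOmegaGeodesic.of_append_left {x y z : V} {p : Γ.Walk x y} {q : Γ.Walk y z}
    (hc : Γ.Connected) (h : IsOmegaGeodesic ω (p.append q)) : IsOmegaGeodesic ω p := by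
  refine le_antisymm (le_passageTime hc fun r => ?_) (passageTime_le _)
  have h1 : omegaLength ω (p.append q) ≤ omegaLength ω (r.append q) := by
    rw [h]; exact passageTime_le _
  rw [omegaLength_append, omegaLength_append] at h1
  exact le_of_add_le_add_right h1

theorem IsOmegaGeodesic.of_append_right {x y z : V} {p : Γ.Walk x y} {q : Γ.Walk y z}
    (hc : Γ.Connected) (h : IsOmegaGeodesic ω (p.append q)) : IsOmegaGeodesic ω q := by
  refine le_antisymm (le_passageTime hc fun r => ?_) (passageTime_le _)
  have h1 : omegaLength ω (p.append q) ≤ omegaLength ω (p.append r) := by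
    rw [h]; exact passageTime_le _
  rw [omegaLength_append, omegaLength_append] at h1
  exact le_of_add_le_add_left h1

theorem IsOmegaGeodesic.exists_subpath (hc : Γ.Connected) {x y u w : V} {p : Γ.Walk x y}
    (hp : IsOmegaGeodesic ω p) (hpath : p.IsPath) (hu : u ∈ p.support) (hw : w ∈ p.support) :
    ∃ q : Γ.Walk u w, IsOmegaGeodesic ω q ∧ q.IsPath ∧ q.support ⊆ p.support := by
  classical
  have e := p.take_spec hu
  by_cases hw' : w ∈ (p.dropUntil u hu).support
  · have e' := (p.dropUntil u hu).take_spec hw'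
    refine ⟨(p.dropUntil u hu).takeUntil w hw', ?_, (hpath.dropUntil hu).takeUntil hw', ?_⟩
    · refine IsOmegaGeodesic.of_append_left (q := (p.dropUntil u hu).dropUntil w hw') hc ?_
      rw [e']
      refine IsOmegaGeodesic.of_append_right (p := p.takeUntil u hu) hc ?_
      rwa [e]
    · exact fun v hv => p.support_dropUntil_subset_support hu
        ((p.dropUntil u hu).support_takeUntil_subset_support hw' hv)
  · have hw2 : w ∈ (p.takeUntil u hu).support := by
      rw [← e, SimpleGraph.Walk.mem_support_append_iff] at hw
      exact hw.resolve_right hw'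
    have e' := (p.takeUntil u hu).take_spec hw2
    refine ⟨((p.takeUntil u hu).dropUntil w hw2).reverse, ?_,
      ((hpath.takeUntil hu).dropUntil hw2).reverse, ?_⟩
    · refine IsOmegaGeodesic.reverse hc ?_
      refine IsOmegaGeodesic.of_append_right (p := (p.takeUntil u hu).takeUntil w hw2) hc ?_
      rw [e']
      refine IsOmegaGeodesic.of_append_left (q := p.dropUntil u hu) hc ?_
      rwa [e]
    · rw [SimpleGraph.Walk.support_reverse]
      intro v hv
      exact p.support_takeUntil_subset_support hu
        ((p.takeUntil u hu).support_dropUntil_subset_support hw2 (List.mem_reverse.1 hv))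

theorem omegaLength_le_mul_length {x y : V} (p : Γ.Walk x y) {b : ℝ≥0}
    (h : ∀ d ∈ p.darts, ω ⟨d.edge, d.edge_mem⟩ ≤ b) : omegaLength ω p ≤ b * p.length := by
  have := List.sum_le_card_nsmul (p.darts.map fun e => ω ⟨e.edge, e.edge_mem⟩) b (by
    intro a ha
    obtain ⟨d, hd, rfl⟩ := List.mem_map.1 ha
    exact h d hd)
  rw [List.length_map, SimpleGraph.Walk.length_darts, nsmul_eq_mul, mul_comm] at this
  exact this

theorem mul_length_le_omegaLength {x y : V} (p : Γ.Walk x y) {b : ℝ≥0}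
    (h : ∀ d ∈ p.darts, b ≤ ω ⟨d.edge, d.edge_mem⟩) : b * p.length ≤ omegaLength ω p := by
  have := List.card_nsmul_le_sum (p.darts.map fun e => ω ⟨e.edge, e.edge_mem⟩) b (by
    intro a ha
    obtain ⟨d, hd, rfl⟩ := List.mem_map.1 ha
    exact h d hd)
  rw [List.length_map, SimpleGraph.Walk.length_darts, nsmul_eq_mul, mul_comm] at this
  exact this

theorem omegaLength_mono {ω' : Config Γ} (h : ω ≤ ω') {x y : V} (p : Γ.Walk x y) :
    omegaLength ω p ≤ omegaLength ω' p :=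
  List.sum_le_sum fun _ _ => h _

end PassageTime

/-! ### Stability of `ω`-geodesics -/

/-- Seen from `p`, the `ω`-length of paths is comparable to their number of edges, with an error
that grows linearly with the distance of the starting vertex to `p`. -/
def HasLinearGrowth {V : Type*} {Γ : SimpleGraph V} (ω : Config Γ) (c B R : ℝ) (p : V) : Prop :=
  ∀ (q y : V) (τ : Γ.Walk q y), τ.IsPath →
    c * τ.length ≤ omegaLength ω τ + (R + Γ.dist q p) ∧
      omegaLength ω τ ≤ B * τ.length + (R + Γ.dist q p)

section Stability

variable {V : Type*} {Γ : SimpleGraph V} {ω : Config Γ} {c B R : ℝ} {p : V}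

theorem HasLinearGrowth.passageTime_le (hc : Γ.Connected) (h : HasLinearGrowth ω c B R p)
    (x y : V) : (passageTime ω x y : ℝ) ≤ B * Γ.dist x y + (R + Γ.dist x p) := by
  obtain ⟨g, hg⟩ := exists_isWordGeodesic hc x y
  have h1 := (h x y g (g.isPath_of_length_eq_dist hg)).2
  rw [show g.length = Γ.dist x y from hg] at h1
  have h2 : (passageTime ω x y : ℝ) ≤ omegaLength ω g := by
    exact_mod_cast FPP.passageTime_le g
  linarith

theorem HasLinearGrowth.mul_length_le (hc : Γ.Connected) (h : HasLinearGrowth ω c B R p)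
    {x y : V} (q : Γ.Walk x y) (hq : q.IsPath) (hω : IsOmegaGeodesic ω q) :
    c * q.length ≤ B * Γ.dist x y + 2 * (R + Γ.dist x p) := by
  have h1 := (h x y q hq).1
  have h2 := h.passageTime_le hc x y
  rw [← hω] at h2
  linarith

/-- Stability of geodesics: an `ω`-geodesic passes within `H` of every vertex of a word geodesic
with the same endpoints which is close to `p`. The vertex of the word geodesic to look at
is not the one farthest from the `ω`-geodesic but the one maximizing this distance minus a
quarter of the distance to the given vertex: this keeps the errors, which depend on the distance
to `p`, under control. -/
theorem HasLinearGrowth.exists_mem_support_dist_le {δ : ℕ} (hc : Γ.Connected) (hs : IsSlim Γ δ)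
    (hB : 0 ≤ B) (hgrow : HasLinearGrowth ω c B R p) {x y : V} {σ : Γ.Walk x y}
    (hσ : IsOmegaGeodesic ω σ) (hpath : σ.IsPath) {v₀ : V} (hv₀ : Between Γ x v₀ y) {C : ℕ}
    (hC : Γ.dist v₀ p ≤ C) {H : ℕ}
    (hH : ∀ h > H, ∃ m : ℕ, m * δ < h ∧
      ∀ n : ℕ, c * n ≤ B * (12 * h) + 2 * (R + (10 * h + C)) → n + 4 * h ≤ 2 ^ m) :
    ∃ u ∈ σ.support, Γ.dist v₀ u ≤ H := by
  classical
  by_contra hcon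
  push Not at hcon
  obtain ⟨g, hg, hg0, hgL, hgj⟩ := hv₀.exists_isGeodesicSegment hc
  have hj₀ : Γ.dist x v₀ ≤ Γ.dist x y := by unfold Between at hv₀; omega
  generalize Γ.dist x v₀ = j₀ at hgj hj₀
  generalize Γ.dist x y = L at hg hgL hj₀
  have hnear : ∀ v : V, ∃ u ∈ σ.support, ∀ w ∈ σ.support, Γ.dist v u ≤ Γ.dist v w := fun v => by
    obtain ⟨u, hu, hmin⟩ := Finset.exists_min_image σ.support.toFinset (fun w => Γ.dist v w)
      ⟨x, by simp⟩
    exact ⟨u, by simpa using hu, fun w hw => hmin w (by simpa using hw)⟩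
  choose f hf hfmin using hnear
  obtain ⟨j, hj, hmax⟩ := Finset.exists_max_image (Finset.range (L + 1))
    (fun i => 4 * (Γ.dist (g i) (f (g i)) : ℤ) - |(i : ℤ) - j₀|) ⟨0, by simp⟩
  have hjL : j ≤ L := by simpa [Nat.lt_succ_iff] using hj
  generalize hh : Γ.dist (g j) (f (g j)) = h at hmax
  have hmax' : ∀ i ≤ L, 4 * (Γ.dist (g i) (f (g i)) : ℤ) - |(i : ℤ) - j₀| ≤
      4 * (h : ℤ) - |(j : ℤ) - j₀| := fun i hi => hmax i (by simp; omega)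
  have h0 := hmax' j₀ hj₀
  rw [hgj, sub_self, abs_zero] at h0
  have hH0 := hcon _ (hf v₀)
  have hhH : H < h := by
    have := abs_nonneg ((j : ℤ) - j₀)
    omega
  have hjj : |(j : ℤ) - j₀| ≤ 4 * h := by omega
  have hslope : ∀ i ≤ L, 4 * (Γ.dist (g i) (f (g i)) : ℤ) ≤ 4 * h + |(i : ℤ) - j| := fun i hi => by
    have h1 := hmax' i hi
    have h2 := abs_sub_le (i : ℤ) j j₀
    omega
  have hfar : ∀ w ∈ σ.support, h ≤ Γ.dist (g j) w := fun w hw => by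
    rw [← hh]; exact hfmin _ w hw
  -- The two ends of the detour: each joins a vertex of the word geodesic to the `ω`-geodesic
  -- and avoids the ball of radius `h` around `g j`.
  have hend : ∀ i ≤ L, (|(i : ℤ) - j| = 4 * h ∨ ((i = 0 ∨ i = L) ∧ |(i : ℤ) - j| ≤ 4 * h)) →
      ∃ u ∈ σ.support, ∃ α : Γ.Walk (g i) u, α.length ≤ 2 * h ∧
        ∀ v ∈ α.support, h ≤ Γ.dist (g j) v := by
    intro i hi hcase
    rcases hcase with hcase | ⟨hcase, -⟩
    · obtain ⟨α, hα⟩ := exists_isWordGeodesic hc (g i) (f (g i))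
      have h1 := hslope i hi
      have hα' : α.length = Γ.dist (g i) (f (g i)) := hα
      refine ⟨f (g i), hf _, α, by omega, fun v hv => ?_⟩
      have h2 := dist_add_dist_eq_of_mem_support hc α hα hv
      have h3 := hg.dist_eq hi hjL
      have h4 := hc.dist_triangle (u := g i) (v := v) (w := g j)
      rw [Γ.dist_comm (u := v)] at h4
      unfold Between at h2
      omega
    · have hmem : g i ∈ σ.support := by
        rcases hcase with rfl | rfl
        · rw [hg0]; exact σ.start_mem_support
        · rw [hgL]; exact σ.end_mem_support
      refine ⟨g i, hmem, SimpleGraph.Walk.nil, by simp, fun v hv => ?_⟩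
      rw [SimpleGraph.Walk.mem_support_nil_iff] at hv
      rw [hv]
      exact hfar _ hmem
  have hl : j - 4 * h ≤ L := by omega
  have hr : min (j + 4 * h) L ≤ L := min_le_right _ _
  have hlj : j - 4 * h ≤ j := by omega
  have hjr : j ≤ min (j + 4 * h) L := by omega
  have hlabs : |((j - 4 * h : ℕ) : ℤ) - j| ≤ 4 * h := by
    rw [abs_of_nonpos (by omega)]; omega
  have hrabs : |((min (j + 4 * h) L : ℕ) : ℤ) - j| ≤ 4 * h := by
    rw [abs_of_nonneg (by omega)]; omega
  obtain ⟨u, hu, α, hα, hαfar⟩ := hend (j - 4 * h) hl (by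
    by_cases hz : 4 * h ≤ j
    · left; rw [abs_of_nonpos (by omega)]; omega
    · exact Or.inr ⟨Or.inl (by omega), hlabs⟩)
  obtain ⟨w, hw, β, hβ, hβfar⟩ := hend (min (j + 4 * h) L) hr (by
    by_cases hz : j + 4 * h ≤ L
    · left; rw [abs_of_nonneg (by omega)]; omega
    · exact Or.inr ⟨Or.inr (by omega), hrabs⟩)
  obtain ⟨τ, hτ, hτp, hτs⟩ := hσ.exists_subpath hc hpath hu hw
  have hbt := hg.between hlj hjr hr
  have hglr := hg.dist_eq hl hr
  have hdl := hg.dist_eq hl hjL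
  have hdj := hg.dist_eq hjL hj₀
  generalize j - 4 * h = l at *
  generalize min (j + 4 * h) L = r at *
  have hduw : Γ.dist u w ≤ 12 * h := by
    have h1 := SimpleGraph.dist_le α
    have h2 := SimpleGraph.dist_le β
    have h3 := hc.dist_triangle (u := u) (v := g l) (w := w)
    have h4 := hc.dist_triangle (u := g l) (v := g r) (w := w)
    have h5 := abs_sub_le (l : ℤ) j r
    rw [abs_sub_comm (j : ℤ) r] at h5
    rw [Γ.dist_comm (u := u) (v := g l)] at h3
    omega
  have hdup : Γ.dist u p ≤ 10 * h + C := by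
    have h1 := SimpleGraph.dist_le α
    have h3 := hc.dist_triangle (u := u) (v := g l) (w := p)
    have h4 := hc.dist_triangle (u := g l) (v := g j) (w := p)
    have h5 := hc.dist_triangle (u := g j) (v := v₀) (w := p)
    rw [hgj] at hdj
    rw [Γ.dist_comm (u := u) (v := g l)] at h3
    omega
  obtain ⟨m, hm, hmn⟩ := hH h hhH
  have hlen := hmn τ.length (by
    have h1 := hgrow.mul_length_le hc τ hτp hτ
    have h2 : (Γ.dist u w : ℝ) ≤ 12 * h := by exact_mod_cast hduw
    have h3 : (Γ.dist u p : ℝ) ≤ 10 * h + C := by exact_mod_cast hdup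
    nlinarith [mul_le_mul_of_nonneg_left h2 hB])
  obtain ⟨v, hv, hvd⟩ := hs.exists_mem_support_dist_le hc m ((α.append τ).append β.reverse) hbt (by
    rw [SimpleGraph.Walk.length_append, SimpleGraph.Walk.length_append,
      SimpleGraph.Walk.length_reverse]
    omega)
  have : h ≤ Γ.dist (g j) v := by
    rw [SimpleGraph.Walk.mem_support_append_iff, SimpleGraph.Walk.mem_support_append_iff] at hv
    rcases hv with (hv | hv) | hv
    · exact hαfar v hv
    · exact hfar v (hτs hv)
    · rw [SimpleGraph.Walk.support_reverse, List.mem_reverse] at hv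
      exact hβfar v hv
  omega

end Stability

/-! ### Corridors of cheap edges -/

/-- The edges with both endpoints within `M` of `p`. -/
def nearEdges {V : Type*} (Γ : SimpleGraph V) (p : V) (M : ℕ) : Set Γ.edgeSet :=
  {e | ∀ v ∈ (e : Sym2 V), Γ.dist v p ≤ M}

/-- The edge `e` is one of the first `n` edges of the path `s`. -/
def IsSegmentEdge {V : Type*} {Γ : SimpleGraph V} (n : ℕ) (s : ℕ → V) (e : Γ.edgeSet) : Prop :=
  ∃ i < n, (e : Sym2 V) = s(s i, s (i + 1))

/-- In the ball of radius `M` around the midpoint `s N` of the path `s 0, …, s (2 * N)`, the edges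
of this path have weights in `[a₀, a₁]` and all the other edges have weights in `[b₀, b₁]`. -/
def HasCorridor {V : Type*} {Γ : SimpleGraph V} (ω : Config Γ) (a₀ a₁ b₀ b₁ : ℝ≥0) (N M : ℕ)
    (s : ℕ → V) : Prop :=
  ∀ e ∈ nearEdges Γ (s N) M,
    (IsSegmentEdge (2 * N) s e → ω e ∈ Set.Icc a₀ a₁) ∧
      (¬ IsSegmentEdge (2 * N) s e → ω e ∈ Set.Icc b₀ b₁)

section Corridor

variable {V : Type*} {Γ : SimpleGraph V} {ω : Config Γ}

/-- Cutting a walk at its first vertex in `P`, or at its end if there is none. -/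
theorem exists_append_of_first_mem (P : V → Prop) {u w : V} (τ : Γ.Walk u w) :
    ∃ (b : V) (τ₁ : Γ.Walk u b) (τ₂ : Γ.Walk b w), τ = τ₁.append τ₂ ∧ (P b ∨ b = w) ∧
      ∀ d ∈ τ₁.darts, ¬ P d.fst := by
  induction τ with
  | nil => exact ⟨_, SimpleGraph.Walk.nil, SimpleGraph.Walk.nil, by simp, Or.inr rfl, by simp⟩
  | @cons u v w h τ ih =>
    by_cases hu : P u
    · exact ⟨u, SimpleGraph.Walk.nil, SimpleGraph.Walk.cons h τ, by simp, Or.inl hu, by simp⟩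
    · obtain ⟨b, τ₁, τ₂, e, hb, hd⟩ := ih
      refine ⟨b, SimpleGraph.Walk.cons h τ₁, τ₂, by rw [e]; simp, hb, fun d hdm => ?_⟩
      rw [SimpleGraph.Walk.darts_cons, List.mem_cons] at hdm
      rcases hdm with rfl | hdm
      · exact hu
      · exact hd d hdm

/-- Cutting a walk at its last vertex in `P`, or at its start if there is none. -/
theorem exists_append_of_last_mem (P : V → Prop) {u w : V} (τ : Γ.Walk u w) :
    ∃ (a : V) (τ₁ : Γ.Walk u a) (τ₂ : Γ.Walk a w), τ = τ₁.append τ₂ ∧ (P a ∨ a = u) ∧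
      ∀ d ∈ τ₂.darts, ¬ P d.snd := by
  obtain ⟨a, τ₁, τ₂, e, ha, hd⟩ := exists_append_of_first_mem P τ.reverse
  refine ⟨a, τ₂.reverse, τ₁.reverse, ?_, ha, fun d hdm => ?_⟩
  · rw [← SimpleGraph.Walk.reverse_append, ← e, SimpleGraph.Walk.reverse_reverse]
  · rw [SimpleGraph.Walk.mem_darts_reverse] at hdm
    exact hd _ hdm

theorem passageTime_le_mul_dist (hc : Γ.Connected) {p : V} {M : ℕ} {b : ℝ≥0}
    (h : ∀ e ∈ nearEdges Γ p M, ω e ≤ b) {v w : V} (hv : Γ.dist v p + Γ.dist v w ≤ M) :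
    passageTime ω v w ≤ b * Γ.dist v w := by
  obtain ⟨g, hg⟩ := exists_isWordGeodesic hc v w
  rw [← show g.length = Γ.dist v w from hg]
  refine (passageTime_le g).trans (omegaLength_le_mul_length g fun d hd => h _ fun z hz => ?_)
  have hz' : z ∈ g.support := by
    rcases Sym2.mem_iff.1 hz with rfl | rfl
    · exact g.dart_fst_mem_support_of_mem_darts hd
    · exact g.dart_snd_mem_support_of_mem_darts hd
  have h1 := dist_add_dist_eq_of_mem_support hc g hg hz'
  have h2 := hc.dist_triangle (u := z) (v := v) (w := p)
  rw [Γ.dist_comm (u := z) (v := v)] at h2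
  unfold Between at h1
  omega

theorem IsGeodesicSegment.adj {n : ℕ} {s : ℕ → V} (h : IsGeodesicSegment Γ n s) {i : ℕ}
    (hi : i < n) : Γ.Adj (s i) (s (i + 1)) := by
  have := h i (i + 1) (Nat.le_succ i) hi
  exact SimpleGraph.dist_eq_one_iff_adj.1 (by omega)

theorem passageTime_le_of_segment (hc : Γ.Connected) {n : ℕ} {s : ℕ → V} {a : ℝ≥0}
    (hs : IsGeodesicSegment Γ n s) (h : ∀ e : Γ.edgeSet, IsSegmentEdge n s e → ω e ≤ a) {i : ℕ}
    (k : ℕ) (hik : i + k ≤ n) : passageTime ω (s i) (s (i + k)) ≤ a * k := by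
  induction k with
  | zero =>
    have := passageTime_le (ω := ω) (SimpleGraph.Walk.nil : Γ.Walk (s i) (s i))
    simpa using this
  | succ k ih =>
    have hadj := hs.adj (i := i + k) (by omega)
    have h1 := passageTime_le (ω := ω) (SimpleGraph.Walk.cons hadj SimpleGraph.Walk.nil)
    rw [omegaLength_cons, omegaLength_nil, add_zero] at h1
    have h2 := h ⟨_, hadj⟩ ⟨i + k, by omega, rfl⟩
    have h3 := ih (by omega)
    have h4 := passageTime_triangle (ω := ω) hc (s i) (s (i + k)) (s (i + k + 1))
    calc passageTime ω (s i) (s (i + (k + 1))) ≤ a * k + a :=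
          h4.trans (add_le_add h3 (h1.trans h2))
      _ = a * (k + 1 : ℕ) := by push_cast; ring

/-- If the edges of the segment `s` are cheap, an `ω`-geodesic whose ends are close to the ends of
`s`, and which stays in the region where the other edges are expensive, passes through
the midpoint of `s`: otherwise it contains an excursion joining the two halves of `s`
without using the edges of `s`, and it is shorter to follow `s`. -/
theorem HasCorridor.mem_support_of_near {a₀ a₁ b₀ b₁ : ℝ≥0} {N M : ℕ} {s : ℕ → V}
    (hc : Γ.Connected) (hs : IsGeodesicSegment Γ (2 * N) s)
    (hcor : HasCorridor ω a₀ a₁ b₀ b₁ N M s) (hab : a₁ < b₀) (hb : b₀ ≤ b₁) {k : ℕ}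
    (hk : ((b₀ : ℝ) + b₁) * (2 * k) < (b₀ - a₁) * N) (hkN : k ≤ N) (hM : 3 * N ≤ M)
    {u w : V} (hu : Γ.dist u (s 0) ≤ k) (hw : Γ.dist (s (2 * N)) w ≤ k) {τ : Γ.Walk u w}
    (hτ : IsOmegaGeodesic ω τ) (hτM : ∀ v ∈ τ.support, Γ.dist v (s N) ≤ M) :
    s N ∈ τ.support := by
  by_contra hN
  have hab' : (0 : ℝ) < b₀ - a₁ := sub_pos.2 (by exact_mod_cast hab)
  have hNpos : 0 < N := by
    rcases Nat.eq_zero_or_pos N with h0 | h0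
    · rw [h0, Nat.cast_zero, mul_zero] at hk
      exact absurd hk (not_lt.2 (by positivity))
    · exact h0
  obtain ⟨b, τ₁, τ₂, e₁, hb', hd₁⟩ :=
    exists_append_of_first_mem (fun v => ∃ i, N < i ∧ i ≤ 2 * N ∧ v = s i) τ
  obtain ⟨a, τ₃, τ₄, e₂, ha', hd₂⟩ :=
    exists_append_of_last_mem (fun v => ∃ i, i < N ∧ v = s i) τ₁
  have hgeo : IsOmegaGeodesic ω τ₄ := by
    rw [e₁, e₂] at hτ
    exact (hτ.of_append_left hc).of_append_right hc
  have hsupp : ∀ v ∈ τ₄.support, v ∈ τ.support := fun v hv => by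
    rw [e₁, e₂, SimpleGraph.Walk.mem_support_append_iff, SimpleGraph.Walk.mem_support_append_iff]
    exact Or.inl (Or.inr hv)
  have hdarts : ∀ d ∈ τ₄.darts, d ∈ τ₁.darts := fun d hd => by
    rw [e₂, SimpleGraph.Walk.darts_append]
    exact List.mem_append_right _ hd
  have hnear : ∀ d ∈ τ₄.darts, (⟨d.edge, d.edge_mem⟩ : Γ.edgeSet) ∈ nearEdges Γ (s N) M :=
    fun d hd z hz => by
      refine hτM z (hsupp z ?_)
      rcases Sym2.mem_iff.1 hz with rfl | rfl
      · exact τ₄.dart_fst_mem_support_of_mem_darts hd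
      · exact τ₄.dart_snd_mem_support_of_mem_darts hd
  have hoff : ∀ d ∈ τ₄.darts, ¬ IsSegmentEdge (2 * N) s (⟨d.edge, d.edge_mem⟩ : Γ.edgeSet) := by
    rintro d hd ⟨i, hi, he⟩
    have hf := hd₁ d (hdarts d hd)
    have hg := hd₂ d hd
    have hmf : d.fst ≠ s N := fun h => hN (h ▸ hsupp _ (τ₄.dart_fst_mem_support_of_mem_darts hd))
    have hmg : d.snd ≠ s N := fun h => hN (h ▸ hsupp _ (τ₄.dart_snd_mem_support_of_mem_darts hd))
    have he' : s(d.fst, d.snd) = s(s i, s (i + 1)) := he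
    have hcase : i = N ∨ i + 1 = N ∨ i + 1 < N ∨ N < i := by omega
    rcases Sym2.eq_iff.1 he' with ⟨h1, h2⟩ | ⟨h1, h2⟩
    · rcases hcase with h | h | h | h
      · exact hmf (h ▸ h1)
      · exact hmg (h ▸ h2)
      · exact hg ⟨i + 1, h, h2⟩
      · exact hf ⟨i, h, by omega, h1⟩
    · rcases hcase with h | h | h | h
      · exact hmg (h ▸ h2)
      · exact hmf (h ▸ h1)
      · exact hg ⟨i, by omega, h2⟩
      · exact hf ⟨i + 1, by omega, by omega, h1⟩
  have hlow := mul_length_le_omegaLength (ω := ω) (b := b₀) τ₄ fun d hd =>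
    ((hcor _ (hnear d hd)).2 (hoff d hd)).1
  obtain ⟨ia, ka, hia, hka, hda, hka0⟩ : ∃ ia ka, ia < N ∧ ka ≤ k ∧ Γ.dist a (s ia) ≤ ka ∧
      (ka = 0 ∨ ia = 0) := by
    rcases ha' with ⟨i, hi, rfl⟩ | rfl
    · exact ⟨i, 0, hi, Nat.zero_le _, by simp, Or.inl rfl⟩
    · exact ⟨0, k, hNpos, le_rfl, hu, Or.inr rfl⟩
  obtain ⟨ib, kb, hib, hib2, hkb, hdb, hkb0⟩ : ∃ ib kb, N < ib ∧ ib ≤ 2 * N ∧ kb ≤ k ∧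
      Γ.dist (s ib) b ≤ kb ∧ (kb = 0 ∨ ib = 2 * N) := by
    rcases hb' with ⟨i, hi, hi2, rfl⟩ | rfl
    · exact ⟨i, 0, hi, hi2, Nat.zero_le _, by simp, Or.inl rfl⟩
    · exact ⟨2 * N, k, by omega, le_rfl, le_rfl, hw, Or.inr rfl⟩
  have hseg : ∀ e : Γ.edgeSet, IsSegmentEdge (2 * N) s e → ω e ≤ a₁ := by
    rintro e ⟨i, hi, he⟩
    refine ((hcor e fun v hv => ?_).1 ⟨i, hi, he⟩).2
    rw [he] at hv
    have h1 := hs.dist_eq (i := i) (j := N) hi.le (by omega)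
    have h2 := hs.dist_eq (i := i + 1) (j := N) hi (by omega)
    rcases Sym2.mem_iff.1 hv with rfl | rfl
    · rcases abs_cases ((i : ℤ) - N) with h | h <;> omega
    · rcases abs_cases (((i + 1 : ℕ) : ℤ) - N) with h | h <;> omega
  have hall : ∀ e ∈ nearEdges Γ (s N) M, ω e ≤ b₁ := fun e he => by
    by_cases hse : IsSegmentEdge (2 * N) s e
    · exact (((hcor e he).1 hse).2.trans hab.le).trans hb
    · exact ((hcor e he).2 hse).2
  have hsa := hs.dist_eq (i := ia) (j := N) (by omega) (by omega)
  have hsb := hs.dist_eq (i := ib) (j := N) (by omega) (by omega)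
  have hsab := hs ia ib (by omega) hib2
  rw [abs_of_nonpos (by omega)] at hsa
  rw [abs_of_nonneg (by omega)] at hsb
  have hup : passageTime ω a b ≤ b₁ * Γ.dist a (s ia) + a₁ * (ib - ia : ℕ) +
      b₁ * Γ.dist (s ib) b := by
    have h1 : passageTime ω a (s ia) ≤ b₁ * Γ.dist a (s ia) := by
      refine passageTime_le_mul_dist hc hall ?_
      have := hc.dist_triangle (u := a) (v := s ia) (w := s N)
      omega
    have h2 : passageTime ω (s ib) b ≤ b₁ * Γ.dist (s ib) b :=
      passageTime_le_mul_dist hc hall (by omega)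
    have h3 := passageTime_le_of_segment hc hs hseg (i := ia) (ib - ia) (by omega)
    rw [Nat.add_sub_cancel' (by omega)] at h3
    exact (passageTime_triangle hc a (s ib) b).trans
      (add_le_add ((passageTime_triangle hc a (s ia) (s ib)).trans (add_le_add h1 h3)) h2)
  rw [← hgeo] at hup
  have hfin := hlow.trans hup
  have hlen : ib - ia ≤ τ₄.length + ka + kb := by
    have h1 := SimpleGraph.dist_le τ₄
    have h2 := hc.dist_triangle (u := s ia) (v := a) (w := s ib)
    have h3 := hc.dist_triangle (u := a) (v := b) (w := s ib)
    rw [Γ.dist_comm (u := s ia) (v := a)] at h2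
    rw [Γ.dist_comm (u := b)] at h3
    omega
  have hfin' : (b₀ : ℝ) * τ₄.length ≤ b₁ * Γ.dist a (s ia) + a₁ * (ib - ia : ℕ) +
      b₁ * Γ.dist (s ib) b := by exact_mod_cast hfin
  generalize hn : ib - ia = n at *
  have hlen' : (n : ℝ) ≤ τ₄.length + ka + kb := by exact_mod_cast hlen
  have hda' : (Γ.dist a (s ia) : ℝ) ≤ ka := by exact_mod_cast hda
  have hdb' : (Γ.dist (s ib) b : ℝ) ≤ kb := by exact_mod_cast hdb
  have hka' : (ka : ℝ) ≤ k := by exact_mod_cast hka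
  have hkb' : (kb : ℝ) ≤ k := by exact_mod_cast hkb
  have hb₀ : (0 : ℝ) ≤ b₀ := b₀.2
  have hb₁ : (0 : ℝ) ≤ b₁ := b₁.2
  have key : ((b₀ : ℝ) - a₁) * n ≤ (b₀ + b₁) * (ka + kb) := by
    have h1 := mul_le_mul_of_nonneg_left hlen' hb₀
    have h2 := mul_le_mul_of_nonneg_left hda' hb₁
    have h3 := mul_le_mul_of_nonneg_left hdb' hb₁
    nlinarith
  by_cases h0 : ka = 0 ∧ kb = 0
  · rw [h0.1, h0.2] at key
    have : (0 : ℝ) < n := by exact_mod_cast (by omega : 0 < n)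
    have := mul_pos hab' this
    simp at key
    linarith
  · have hNn : N ≤ n := by omega
    have h1 : ((b₀ : ℝ) - a₁) * N ≤ (b₀ - a₁) * n :=
      mul_le_mul_of_nonneg_left (by exact_mod_cast hNn) hab'.le
    have h2 : ((b₀ : ℝ) + b₁) * (ka + kb) ≤ (b₀ + b₁) * (2 * k) :=
      mul_le_mul_of_nonneg_left (by linarith) (by linarith)
    linarith

/-- A corridor of cheap edges around the midpoint of `s`, together with the linear growth of
lengths, forces all the `ω`-geodesics that cross the corridor through this midpoint. -/
theorem HasCorridor.mem_support {δ : ℕ} {a₀ a₁ b₀ b₁ : ℝ≥0} {c B R : ℝ} {N M H : ℕ}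
    {s : ℕ → V} (hc : Γ.Connected) (hslim : IsSlim Γ δ) (hs : IsGeodesicSegment Γ (2 * N) s)
    (hcor : HasCorridor ω a₀ a₁ b₀ b₁ N M s) (hab : a₁ < b₀) (hb : b₀ ≤ b₁) (hB : 0 ≤ B)
    (hgrow : HasLinearGrowth ω c B R (s N))
    (hk : ((b₀ : ℝ) + b₁) * (2 * (H + 2 * δ : ℕ)) < (b₀ - a₁) * N) (hkN : H + 2 * δ ≤ N)
    (hH : ∀ h > H, ∃ m : ℕ, m * δ < h ∧
      ∀ n : ℕ, c * n ≤ B * (12 * h) + 2 * (R + (10 * h + (N + 2 * δ : ℕ))) → n + 4 * h ≤ 2 ^ m)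
    (hM : ∀ n : ℕ, c * n ≤ B * (4 * N) + 2 * (R + 2 * N) → n + 3 * N ≤ M)
    {x y : V} {σ : Γ.Walk x y} (hσ : IsOmegaGeodesic ω σ) (hpath : σ.IsPath)
    (hx : ∃ v, Γ.dist (s 0) v ≤ 2 * δ ∧ Between Γ x v y)
    (hy : ∃ v, Γ.dist (s (2 * N)) v ≤ 2 * δ ∧ Between Γ x v y) : s N ∈ σ.support := by
  have hend : ∀ i, i ≤ 2 * N → Γ.dist (s i) (s N) ≤ N →
      (∃ v, Γ.dist (s i) v ≤ 2 * δ ∧ Between Γ x v y) →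
      ∃ u ∈ σ.support, Γ.dist (s i) u ≤ H + 2 * δ := by
    rintro i - hiN ⟨v, hv, hbt⟩
    have h1 := hc.dist_triangle (u := v) (v := s i) (w := s N)
    rw [Γ.dist_comm (u := v) (v := s i)] at h1
    obtain ⟨u, hu, hd⟩ := hgrow.exists_mem_support_dist_le hc hslim hB hσ hpath hbt
      (C := N + 2 * δ) (by omega) hH
    have h2 := hc.dist_triangle (u := s i) (v := v) (w := u)
    exact ⟨u, hu, by omega⟩
  have e0 := hs 0 N (Nat.zero_le _) (by omega)
  have e1 := hs N (2 * N) (by omega) le_rfl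
  have e2 := hs 0 (2 * N) (Nat.zero_le _) le_rfl
  obtain ⟨u, hu, hdu⟩ := hend 0 (Nat.zero_le _) (by omega) hx
  obtain ⟨w, hw, hdw⟩ := hend (2 * N) le_rfl (by rw [SimpleGraph.dist_comm]; omega) hy
  obtain ⟨τ, hτ, hτp, hτs⟩ := hσ.exists_subpath hc hpath hu hw
  have hduN : Γ.dist u (s N) ≤ 2 * N := by
    have := hc.dist_triangle (u := u) (v := s 0) (w := s N)
    rw [Γ.dist_comm (u := u) (v := s 0)] at this
    omega
  have hduw : Γ.dist u w ≤ 4 * N := by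
    have h1 := hc.dist_triangle (u := u) (v := s 0) (w := w)
    have h2 := hc.dist_triangle (u := s 0) (v := s (2 * N)) (w := w)
    rw [Γ.dist_comm (u := u) (v := s 0)] at h1
    omega
  have hlen := hM τ.length (by
    have h1 := hgrow.mul_length_le hc τ hτp hτ
    have h2 : (Γ.dist u w : ℝ) ≤ 4 * N := by exact_mod_cast hduw
    have h3 : (Γ.dist u (s N) : ℝ) ≤ 2 * N := by exact_mod_cast hduN
    have h4 := mul_le_mul_of_nonneg_left h2 hB
    linarith)
  refine hτs (hcor.mem_support_of_near hc hs hab hb hk hkN (by omega)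
    (by rwa [SimpleGraph.dist_comm]) hdw hτ fun v hv => ?_)
  classical
  have h1 := SimpleGraph.dist_le (τ.takeUntil v hv)
  have h2 := τ.length_takeUntil_le_length hv
  have h3 := hc.dist_triangle (u := v) (v := u) (w := s N)
  rw [Γ.dist_comm (u := v) (v := u)] at h3
  omega

end Corridor

/-! ### Choice of the scales -/

theorem exists_nat_forall_gt_exists_le_two_pow (A₁ A₂ : ℝ) (δ : ℕ) :
    ∃ H : ℕ, ∀ h > H, ∃ m : ℕ, m * δ < h ∧ A₁ * h + A₂ ≤ 2 ^ m := by
  have hev : ∀ᶠ m : ℕ in atTop, (|A₁| * (δ + 1) + |A₂|) * (m + 1) ≤ (2 : ℝ) ^ m := by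
    set K := |A₁| * (δ + 1) + |A₂| with hK
    have hK0 : 0 ≤ K := by positivity
    have ht := tendsto_pow_const_div_const_pow_of_one_lt 1 (one_lt_two : (1 : ℝ) < 2)
    have h1 : (0 : ℝ) < 1 / (2 * K + 1) := by positivity
    filter_upwards [ht.eventually (gt_mem_nhds h1), eventually_ge_atTop 1] with m hm hm1
    rw [div_lt_div_iff₀ (by positivity) (by positivity)] at hm
    have : (1 : ℝ) ≤ m := by exact_mod_cast hm1
    nlinarith
  obtain ⟨m₀, hm₀⟩ := eventually_atTop.1 hev
  refine ⟨(δ + 1) * (m₀ + 1), fun h hh => ⟨(h - 1) / (δ + 1), ?_, ?_⟩⟩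
  · have h1 := Nat.div_mul_le_self (h - 1) (δ + 1)
    have h2 : (h - 1) / (δ + 1) * δ ≤ (h - 1) / (δ + 1) * (δ + 1) :=
      Nat.mul_le_mul_left _ (Nat.le_succ δ)
    have : 0 < h := lt_of_le_of_lt (Nat.zero_le _) hh
    omega
  · have hm : m₀ ≤ (h - 1) / (δ + 1) := by
      rw [Nat.le_div_iff_mul_le (Nat.succ_pos _)]
      have e : (δ + 1) * (m₀ + 1) = m₀ * (δ + 1) + (δ + 1) := by ring
      rw [e] at hh
      rw [Nat.succ_eq_add_one]
      omega
    have h1 := hm₀ _ hm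
    have h2 := Nat.lt_div_mul_add (a := h - 1) (b := δ + 1) (Nat.succ_pos _)
    have h3 : (h : ℝ) ≤ (δ + 1) * (((h - 1) / (δ + 1) : ℕ) + 1) := by
      have : h ≤ (δ + 1) * ((h - 1) / (δ + 1) + 1) := by
        rw [mul_add, mul_comm (δ + 1)]; omega
      exact_mod_cast this
    generalize (h - 1) / (δ + 1) = m at *
    have h4 : A₁ * h ≤ |A₁| * ((δ + 1) * (m + 1)) :=
      (mul_le_mul_of_nonneg_right (le_abs_self A₁) (Nat.cast_nonneg h)).trans
        (mul_le_mul_of_nonneg_left h3 (abs_nonneg _))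
    have h5 : A₂ ≤ |A₂| * (m + 1) := by
      have h6 := le_abs_self A₂
      have h7 := abs_nonneg A₂
      have h8 : (0 : ℝ) ≤ m := Nat.cast_nonneg m
      nlinarith
    linarith

/-- The half-length `N` of the corridors can be chosen so large that the distance `H` up to which
`ω`-geodesics are controlled, which is logarithmic in `N`, is small compared to `N`. -/
theorem exists_corridor_scale (δ : ℕ) {c B R κ : ℝ} (hc : 0 < c) (hκ : 0 < κ) :
    ∃ N H : ℕ, ((H + 2 * δ : ℕ) : ℝ) < κ * N ∧ H + 2 * δ ≤ N ∧
      ∀ h > H, ∃ m : ℕ, m * δ < h ∧ ∀ n : ℕ,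
        c * n ≤ B * (12 * h) + 2 * (R + (10 * h + (N + 2 * δ : ℕ))) → n + 4 * h ≤ 2 ^ m := by
  set κ' := min κ 1 with hκ'
  have hκ0 : 0 < κ' := lt_min hκ one_pos
  have hκ1 : κ' ≤ 1 := min_le_right _ _
  obtain ⟨H, hH⟩ := exists_nat_forall_gt_exists_le_two_pow ((B * 12 + 20 + 2 / κ') / c + 4)
    ((2 * (R + (2 * δ / κ' + 1) + 2 * δ)) / c) δ
  have hN := Nat.lt_floor_add_one (((H + 2 * δ : ℕ) : ℝ) / κ')
  have hN' := Nat.floor_le (a := ((H + 2 * δ : ℕ) : ℝ) / κ') (by positivity)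
  refine ⟨⌊((H + 2 * δ : ℕ) : ℝ) / κ'⌋₊ + 1, H, ?_, ?_, fun h hh => ?_⟩
  · rw [div_lt_iff₀ hκ0] at hN
    push_cast at hN ⊢
    have h1 : κ' ≤ κ := min_le_left _ _
    have h2 : (0 : ℝ) ≤ (⌊((H : ℝ) + 2 * δ) / κ'⌋₊ : ℝ) + 1 := by positivity
    nlinarith
  · rw [div_lt_iff₀ hκ0] at hN
    have h2 : (0 : ℝ) ≤ (⌊((H + 2 * δ : ℕ) : ℝ) / κ'⌋₊ : ℝ) + 1 := by positivity
    have : ((H + 2 * δ : ℕ) : ℝ) < (⌊((H + 2 * δ : ℕ) : ℝ) / κ'⌋₊ + 1 : ℕ) := by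
      push_cast at *
      nlinarith
    exact le_of_lt (by exact_mod_cast this)
  · obtain ⟨m, hm, hm2⟩ := hH h hh
    refine ⟨m, hm, fun n hn => ?_⟩
    have hNh : (⌊((H + 2 * δ : ℕ) : ℝ) / κ'⌋₊ : ℝ) ≤ h / κ' + 2 * δ / κ' := by
      refine hN'.trans ?_
      rw [← add_div]
      have : (H : ℝ) ≤ h := by exact_mod_cast hh.le
      push_cast
      gcongr
    have h1 : (n : ℝ) + 4 * h ≤ 2 ^ m := by
      refine le_trans ?_ hm2
      have h2 : (n : ℝ) ≤ ((B * 12 + 20 + 2 / κ') * h +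
          2 * (R + (2 * δ / κ' + 1) + 2 * δ)) / c := by
        rw [le_div_iff₀ hc]
        push_cast at hn hNh
        have h3 : 2 / κ' * h = 2 * (h / κ') := by ring
        nlinarith
      have h4 : ((B * 12 + 20 + 2 / κ') * h + 2 * (R + (2 * δ / κ' + 1) + 2 * δ)) / c =
          (B * 12 + 20 + 2 / κ') / c * h + 2 * (R + (2 * δ / κ' + 1) + 2 * δ) / c := by ring
      rw [h4] at h2
      linarith
    exact_mod_cast h1

open ProbabilityTheory
open scoped ENNReal

/-! ### Independence in a product space -/

/-- The event `A` only depends on the coordinates in `S`. -/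
def DependsOnCoords {ι : Type*} (A : Set (ι → ℝ≥0)) (S : Set ι) : Prop :=
  ∀ ω ω' : ι → ℝ≥0, (∀ e ∈ S, ω e = ω' e) → ω ∈ A → ω' ∈ A

section Independence

variable {ι : Type*} {ρ : Measure ℝ≥0} [IsProbabilityMeasure ρ]

theorem DependsOnCoords.inter {A B : Set (ι → ℝ≥0)} {S T : Set ι} (hA : DependsOnCoords A S)
    (hB : DependsOnCoords B T) : DependsOnCoords (A ∩ B) (S ∪ T) :=
  fun ω ω' h hω => ⟨hA ω ω' (fun e he => h e (Or.inl he)) hω.1,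
    hB ω ω' (fun e he => h e (Or.inr he)) hω.2⟩

theorem DependsOnCoords.mono {A : Set (ι → ℝ≥0)} {S T : Set ι} (hA : DependsOnCoords A S)
    (hST : S ⊆ T) : DependsOnCoords A T :=
  fun ω ω' h hω => hA ω ω' (fun e he => h e (hST he)) hω

/-- Set all the coordinates outside `S` to zero. -/
noncomputable def cutoff {ι : Type*} (S : Set ι) (ω : ι → ℝ≥0) : ι → ℝ≥0 :=
  S.indicator ω

theorem DependsOnCoords.preimage_cutoff {A : Set (ι → ℝ≥0)} {S : Set ι}
    (hA : DependsOnCoords A S) : cutoff S ⁻¹' A = A := by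
  ext ω
  exact ⟨hA _ _ fun e he => Set.indicator_of_mem he _,
    hA _ _ fun e he => (Set.indicator_of_mem he _).symm⟩

theorem indepFun_cutoff {S T : Set ι} (h : Disjoint S T) :
    IndepFun (cutoff S) (cutoff T) (Measure.infinitePi fun _ : ι => ρ) := by
  have hi : iIndepFun (fun (i : ι) (ω : ι → ℝ≥0) => ω i) (Measure.infinitePi fun _ : ι => ρ) :=
    iIndepFun_infinitePi (X := fun _ t => t) fun _ => measurable_id
  have hle : ∀ U : Set ι, MeasurableSpace.comap (cutoff U) inferInstance ≤
      ⨆ i ∈ U, MeasurableSpace.comap (fun ω : ι → ℝ≥0 => ω i) inferInstance := by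
    intro U
    change MeasurableSpace.comap (cutoff U)
      (⨆ i : ι, MeasurableSpace.comap (fun ω : ι → ℝ≥0 => ω i) inferInstance) ≤ _
    rw [MeasurableSpace.comap_iSup]
    refine iSup_le fun i => ?_
    rw [MeasurableSpace.comap_comp]
    by_cases hiU : i ∈ U
    · have : (fun ω : ι → ℝ≥0 => ω i) ∘ cutoff U = fun ω => ω i := by
        ext ω
        simp [cutoff, Set.indicator_of_mem hiU]
      rw [this]
      exact le_iSup₂_of_le i hiU le_rfl
    · have : (fun ω : ι → ℝ≥0 => ω i) ∘ cutoff U = fun _ => 0 := by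
        ext ω
        simp [cutoff, Set.indicator_of_notMem hiU]
      rw [this, MeasurableSpace.comap_const]
      exact bot_le
  exact indep_of_indep_of_le_left (indep_of_indep_of_le_right
    (indep_iSup_of_disjoint (fun i => (measurable_pi_apply i).comap_le) hi h) (hle T)) (hle S)

theorem DependsOnCoords.measure_inter {A B : Set (ι → ℝ≥0)} {S T : Set ι}
    (hA : DependsOnCoords A S) (hB : DependsOnCoords B T) (hST : Disjoint S T)
    (hAm : MeasurableSet A) (hBm : MeasurableSet B) :
    (Measure.infinitePi fun _ : ι => ρ) (A ∩ B) =
      (Measure.infinitePi fun _ : ι => ρ) A * (Measure.infinitePi fun _ : ι => ρ) B := by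
  have := (indepFun_cutoff (ρ := ρ) hST).measure_inter_preimage_eq_mul A B hAm hBm
  rwa [hA.preimage_cutoff, hB.preimage_cutoff] at this

theorem iIndepSet_of_dependsOnCoords {A : ℕ → Set (ι → ℝ≥0)} {S : ℕ → Set ι}
    (hA : ∀ i, DependsOnCoords (A i) (S i)) (hS : Pairwise fun i j => Disjoint (S i) (S j))
    (hAm : ∀ i, MeasurableSet (A i)) : iIndepSet A (Measure.infinitePi fun _ : ι => ρ) := by
  rw [iIndepSet_iff_meas_biInter hAm]
  intro s
  induction s using Finset.induction_on with
  | empty => simp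
  | insert i s hi ih =>
    have hdep : DependsOnCoords (⋂ j ∈ s, A j) (⋃ j ∈ s, S j) := by
      intro ω ω' h hω
      simp only [Set.mem_iInter] at hω ⊢
      exact fun j hj => hA j ω ω' (fun e he => h e (Set.mem_biUnion hj he)) (hω j hj)
    have hdisj : Disjoint (S i) (⋃ j ∈ s, S j) := by
      rw [Set.disjoint_iUnion₂_right]
      exact fun j hj => hS (by rintro rfl; exact hi hj)
    rw [Finset.set_biInter_insert, Finset.prod_insert hi, ← ih]
    exact (hA i).measure_inter hdep hdisj (hAm i)
      (Finset.measurableSet_biInter _ fun j _ => hAm j)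

/-- Chernoff bound for a sum of independent variables, each depending on one coordinate. -/
theorem measure_le_sum_le_exp_mul_pow (f : ι → ℝ≥0 → ℝ) (hf : ∀ e, Measurable (f e)) {K : ℝ≥0∞}
    (hK : ∀ e, ∫⁻ t, ENNReal.ofReal (Real.exp (f e t)) ∂ρ ≤ K) {l : List ι} (hl : l.Nodup)
    (x : ℝ) :
    (Measure.infinitePi fun _ : ι => ρ) {ω | x ≤ (l.map fun e => f e (ω e)).sum} ≤
      ENNReal.ofReal (Real.exp (-x)) * K ^ l.length := by
  classical
  have hg : ∀ e, Measurable fun t => ENNReal.ofReal (Real.exp (f e t)) := fun e =>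
    ENNReal.measurable_ofReal.comp (Real.measurable_exp.comp (hf e))
  have hi : iIndepFun (fun (e : ι) (ω : ι → ℝ≥0) => ENNReal.ofReal (Real.exp (f e (ω e))))
      (Measure.infinitePi fun _ : ι => ρ) :=
    iIndepFun_infinitePi (X := fun e t => ENNReal.ofReal (Real.exp (f e t))) hg
  have hm : ∀ e, Measurable fun ω : ι → ℝ≥0 => ENNReal.ofReal (Real.exp (f e (ω e))) :=
    fun e => (hg e).comp (measurable_pi_apply e)
  have hprod := lintegral_prod_eq_prod_lintegral_of_indepFun l.toFinset _ hi hm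
  have hle : ∏ e ∈ l.toFinset, ∫⁻ ω : ι → ℝ≥0, ENNReal.ofReal (Real.exp (f e (ω e)))
      ∂(Measure.infinitePi fun _ : ι => ρ) ≤ K ^ l.length := by
    rw [← List.toFinset_card_of_nodup hl, ← Finset.prod_const]
    refine Finset.prod_le_prod' fun e _ => ?_
    have := (measurePreserving_eval_infinitePi (fun _ : ι => ρ) e).lintegral_comp (hg e)
    rw [this]
    exact hK e
  have hmarkov := mul_meas_ge_le_lintegral (μ := Measure.infinitePi fun _ : ι => ρ)
    (Finset.measurable_prod l.toFinset fun e _ => hm e) (ENNReal.ofReal (Real.exp x))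
  rw [hprod] at hmarkov
  have hsub : {ω : ι → ℝ≥0 | x ≤ (l.map fun e => f e (ω e)).sum} ⊆
      {ω | ENNReal.ofReal (Real.exp x) ≤
        ∏ e ∈ l.toFinset, ENNReal.ofReal (Real.exp (f e (ω e)))} := by
    intro ω hω
    simp only [Set.mem_ofPred_eq] at hω ⊢
    rw [← ENNReal.ofReal_prod_of_nonneg fun _ _ => (Real.exp_pos _).le, ← Real.exp_sum,
      List.sum_toFinset _ hl]
    exact ENNReal.ofReal_le_ofReal (Real.exp_le_exp.2 hω)
  have hexp : ENNReal.ofReal (Real.exp (-x)) * ENNReal.ofReal (Real.exp x) = 1 := by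
    rw [← ENNReal.ofReal_mul (Real.exp_pos _).le, ← Real.exp_add]
    simp
  calc (Measure.infinitePi fun _ : ι => ρ) {ω | x ≤ (l.map fun e => f e (ω e)).sum}
      ≤ (Measure.infinitePi fun _ : ι => ρ) {ω | ENNReal.ofReal (Real.exp x) ≤
        ∏ e ∈ l.toFinset, ENNReal.ofReal (Real.exp (f e (ω e)))} := measure_mono hsub
    _ = ENNReal.ofReal (Real.exp (-x)) * (ENNReal.ofReal (Real.exp x) *
        (Measure.infinitePi fun _ : ι => ρ) {ω | ENNReal.ofReal (Real.exp x) ≤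
        ∏ e ∈ l.toFinset, ENNReal.ofReal (Real.exp (f e (ω e)))}) := by
          rw [← mul_assoc, hexp, one_mul]
    _ ≤ ENNReal.ofReal (Real.exp (-x)) * K ^ l.length := by
          gcongr
          exact hmarkov.trans hle

end Independence

/-! ### Counting walks -/

section Counting

variable {V : Type*} {Γ : SimpleGraph V} [Γ.LocallyFinite]

open Classical in
/-- The walks with `n` edges that start at `q`. -/
noncomputable def walksFrom (Γ : SimpleGraph V) [Γ.LocallyFinite] :
    ℕ → (q : V) → Finset (Σ y, Γ.Walk q y)
  | 0, q => {⟨q, SimpleGraph.Walk.nil⟩}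
  | n + 1, q => Finset.univ.biUnion fun z : Γ.neighborSet q =>
      (walksFrom Γ n z).image fun w => ⟨w.1, SimpleGraph.Walk.cons z.2 w.2⟩

theorem mem_walksFrom {q y : V} (p : Γ.Walk q y) : ⟨y, p⟩ ∈ walksFrom Γ p.length q := by
  classical
  induction p with
  | nil => simp [walksFrom]
  | @cons u v w h p ih =>
    simp only [SimpleGraph.Walk.length_cons, walksFrom, Finset.mem_biUnion, Finset.mem_univ,
      true_and, Finset.mem_image]
    exact ⟨⟨v, h⟩, ⟨w, p⟩, ih, rfl⟩

theorem card_walksFrom_le {D : ℕ} (hD : ∀ v, Γ.degree v ≤ D) (n : ℕ) (q : V) :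
    (walksFrom Γ n q).card ≤ D ^ n := by
  classical
  induction n generalizing q with
  | zero => simp [walksFrom]
  | succ n ih =>
    rw [walksFrom]
    refine Finset.card_biUnion_le.trans ?_
    calc ∑ z : Γ.neighborSet q, _ ≤ ∑ _z : Γ.neighborSet q, D ^ n :=
          Finset.sum_le_sum fun z _ => Finset.card_image_le.trans (ih z)
      _ = Γ.degree q * D ^ n := by
          rw [Finset.sum_const, smul_eq_mul, Finset.card_univ, SimpleGraph.card_neighborSet_eq_degree]
      _ ≤ D ^ (n + 1) := by
          rw [pow_succ, mul_comm (D ^ n)]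
          exact Nat.mul_le_mul_right _ (hD q)

theorem length_eq_of_mem_walksFrom {n : ℕ} {q : V} {w : Σ y, Γ.Walk q y}
    (hw : w ∈ walksFrom Γ n q) : w.2.length = n := by
  classical
  induction n generalizing q with
  | zero =>
    simp only [walksFrom, Finset.mem_singleton] at hw
    subst hw
    simp
  | succ n ih =>
    simp only [walksFrom, Finset.mem_biUnion, Finset.mem_univ, true_and, Finset.mem_image] at hw
    obtain ⟨z, w', hw', rfl⟩ := hw
    exact congrArg (· + 1) (ih hw')

theorem countable_walk (q : V) : Countable (Σ y, Γ.Walk q y) := by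
  rw [← Set.countable_univ_iff]
  refine (Set.countable_iUnion fun n => (walksFrom Γ n q).countable_toSet).mono fun w _ => ?_
  exact Set.mem_iUnion.2 ⟨w.2.length, mem_walksFrom w.2⟩

theorem countable_of_connected (hc : Γ.Connected) : Countable V := by
  have o : V := hc.nonempty.some
  have := countable_walk (Γ := Γ) o
  refine Function.Surjective.countable (f := fun w : Σ y, Γ.Walk o y => w.1) fun y => ?_
  exact ⟨⟨y, (hc o y).some⟩, rfl⟩

/-- The balls are finite, with a bound on their cardinality which is uniform in the center. -/
theorem exists_ball_subset_finset (hc : Γ.Connected) {D : ℕ} (hD : ∀ v, Γ.degree v ≤ D) (p : V)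
    (M : ℕ) : ∃ F : Finset V, (∀ v, Γ.dist v p ≤ M → v ∈ F) ∧
      F.card ≤ ∑ r ∈ Finset.range (M + 1), D ^ r := by
  classical
  refine ⟨(Finset.range (M + 1)).biUnion fun r => (walksFrom Γ r p).image Sigma.fst,
    fun v hv => ?_, ?_⟩
  · obtain ⟨g, hg⟩ := exists_isWordGeodesic hc p v
    have hg' : g.length = Γ.dist v p := by rw [SimpleGraph.dist_comm]; exact hg
    simp only [Finset.mem_biUnion, Finset.mem_image, Finset.mem_range]
    exact ⟨g.length, by omega, ⟨v, g⟩, mem_walksFrom g, rfl⟩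
  · exact Finset.card_biUnion_le.trans (Finset.sum_le_sum fun r _ =>
      Finset.card_image_le.trans (card_walksFrom_le hD r p))

end Counting

/-! ### Probability estimates for the linear growth of lengths -/

/-- The list of the edges of a path. -/
def edgeList {V : Type*} {Γ : SimpleGraph V} {x y : V} (p : Γ.Walk x y) : List Γ.edgeSet :=
  p.darts.map fun d => ⟨d.edge, d.edge_mem⟩

open Classical in
/-- Replace the weights of the edges in `S` by the constant `a`. -/
noncomputable def override {V : Type*} {Γ : SimpleGraph V} (S : Set Γ.edgeSet) (a : ℝ≥0)
    (ω : Config Γ) : Config Γ :=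
  fun e => if e ∈ S then a else ω e

/-- The two bounds in `HasLinearGrowth` for the path `τ`, with error `t`. The lower and the upper
bound may refer to two different configurations. -/
def GrowthCondition {V : Type*} {Γ : SimpleGraph V} (ω₁ ω₂ : Config Γ) (c B t : ℝ) {x y : V}
    (τ : Γ.Walk x y) : Prop :=
  c * τ.length ≤ omegaLength ω₁ τ + t ∧ omegaLength ω₂ τ ≤ B * τ.length + t

/-- The numbers `c` and `B` are linear growth rates for the weights with law `ρ` in graphs with
degrees at most `D`, with exponential moments of order `l`. The conditions
make the failure probability of `GrowthCondition` for a path with `n` edges smaller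
than `D ^ (-n)`; they also hold for constant weights `a₀` (lower bound) and `b₁` (upper bound). -/
structure IsGrowthRate (ρ : Measure ℝ≥0) (D : ℕ) (a₀ b₁ : ℝ≥0) (l c B : ℝ) : Prop where
  l_pos : 0 < l
  c_pos : 0 < c
  B_nonneg : 0 ≤ B
  decay : (D : ℝ≥0∞) * ENNReal.ofReal (Real.exp (-l)) ≤ 4⁻¹
  upper : ∃ K : ℝ≥0∞, ∫⁻ t : ℝ≥0, ENNReal.ofReal (Real.exp (l * t)) ∂ρ ≤ K ∧
    ENNReal.ofReal (Real.exp (l * b₁)) ≤ K ∧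
    D * (ENNReal.ofReal (Real.exp (-(l * B))) * K) ≤ 4⁻¹
  lower : ∃ K : ℝ≥0∞, ∫⁻ t : ℝ≥0, ENNReal.ofReal (Real.exp (-(l * t))) ∂ρ ≤ K ∧
    ENNReal.ofReal (Real.exp (-(l * a₀))) ≤ K ∧
    D * (ENNReal.ofReal (Real.exp (l * c)) * K) ≤ 4⁻¹

theorem lintegral_exp_mul_lt_top {ρ : Measure ℝ≥0}
    (h : ∃ a : ℝ, 0 < a ∧ Integrable (fun t : ℝ≥0 => Real.exp (a * (t : ℝ) ^ 2)) ρ) (l : ℝ) :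
    ∫⁻ t : ℝ≥0, ENNReal.ofReal (Real.exp (l * t)) ∂ρ < ∞ := by
  obtain ⟨a, ha, hint⟩ := h
  have h2 := (hint.const_mul (Real.exp (l ^ 2 / (4 * a)))).lintegral_lt_top
  refine lt_of_le_of_lt (lintegral_mono fun t => ENNReal.ofReal_le_ofReal ?_) h2
  rw [← Real.exp_add]
  refine Real.exp_le_exp.2 ?_
  have h3 : l ^ 2 / (4 * a) + a * (t : ℝ) ^ 2 - l * t = (2 * a * t - l) ^ 2 / (4 * a) := by
    field_simp
    ring
  have h4 : 0 ≤ (2 * a * t - l) ^ 2 / (4 * a) := by positivity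
  linarith

theorem tendsto_lintegral_exp_neg_mul {ρ : Measure ℝ≥0} [IsProbabilityMeasure ρ]
    (h0 : ρ {0} = 0) :
    Tendsto (fun n : ℕ => ∫⁻ t : ℝ≥0, ENNReal.ofReal (Real.exp (-((n : ℝ) * t))) ∂ρ) atTop
      (nhds 0) := by
  have h := tendsto_lintegral_of_dominated_convergence (μ := ρ)
    (F := fun (n : ℕ) (t : ℝ≥0) => ENNReal.ofReal (Real.exp (-((n : ℝ) * t))))
    (f := fun _ => 0) (fun _ => 1) (fun n => by fun_prop) (fun n => ?_) (by simp) ?_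
  · simpa using h
  · refine Eventually.of_forall fun t => ?_
    simp only [ENNReal.ofReal_le_one, Real.exp_le_one_iff, neg_nonpos]
    positivity
  · have : ∀ᵐ t ∂ρ, t ≠ 0 := by
      rw [ae_iff]
      simpa using h0
    filter_upwards [this] with t ht
    have ht' : (0 : ℝ) < t := by
      have := pos_iff_ne_zero.2 ht
      exact_mod_cast this
    rw [← ENNReal.ofReal_zero]
    refine ENNReal.tendsto_ofReal (Real.tendsto_exp_atBot.comp ?_)
    exact tendsto_neg_atTop_atBot.comp (tendsto_natCast_atTop_atTop.atTop_mul_const ht')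

theorem exists_isGrowthRate {ρ : Measure ℝ≥0} [IsProbabilityMeasure ρ] (h0 : ρ {0} = 0)
    (h : ∃ a : ℝ, 0 < a ∧ Integrable (fun t : ℝ≥0 => Real.exp (a * (t : ℝ) ^ 2)) ρ) (D : ℕ)
    {a₀ : ℝ≥0} (b₁ : ℝ≥0) (ha₀ : 0 < a₀) :
    ∃ l c B : ℝ, IsGrowthRate ρ D a₀ b₁ l c B := by
  have hexp : ∀ a : ℝ, 0 < a →
      Tendsto (fun n : ℕ => ENNReal.ofReal (Real.exp (-((n : ℝ) * a)))) atTop (nhds 0) := by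
    intro a ha
    rw [← ENNReal.ofReal_zero]
    refine ENNReal.tendsto_ofReal (Real.tendsto_exp_atBot.comp ?_)
    exact tendsto_neg_atTop_atBot.comp (tendsto_natCast_atTop_atTop.atTop_mul_const ha)
  have hsmall : ∀ {u : ℕ → ℝ≥0∞} (C : ℝ≥0∞), C ≠ ∞ → Tendsto u atTop (nhds 0) →
      ∀ᶠ n in atTop, C * u n ≤ 4⁻¹ := by
    intro u C hC hu
    have h1 := ENNReal.Tendsto.const_mul (a := C) hu (Or.inr hC)
    rw [mul_zero] at h1
    exact (h1.eventually_lt_const (by simp)).mono fun n hn => hn.le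
  have hmax := (tendsto_lintegral_exp_neg_mul h0).max (hexp a₀ (by exact_mod_cast ha₀))
  rw [max_self] at hmax
  obtain ⟨n, ⟨hn1, hn2⟩, hn0⟩ :=
    (((hsmall D (ENNReal.natCast_ne_top D) (hexp 1 one_pos)).and
      (hsmall (D * ENNReal.ofReal (Real.exp 1))
        (ENNReal.mul_ne_top (ENNReal.natCast_ne_top D) ENNReal.ofReal_ne_top) hmax)).and
        (eventually_ge_atTop 1)).exists
  have hn : (0 : ℝ) < n := by exact_mod_cast hn0
  set K : ℝ≥0∞ := max (∫⁻ t : ℝ≥0, ENNReal.ofReal (Real.exp ((n : ℝ) * t)) ∂ρ)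
    (ENNReal.ofReal (Real.exp ((n : ℝ) * b₁))) with hK
  have hKtop : K ≠ ∞ := (max_lt (lintegral_exp_mul_lt_top h n) ENNReal.ofReal_lt_top).ne
  obtain ⟨B, hB⟩ := (hsmall (D * K) (ENNReal.mul_ne_top (ENNReal.natCast_ne_top D) hKtop)
    (hexp n hn)).exists
  refine ⟨n, 1 / n, B, hn, by positivity, by positivity, ?_, ⟨K, le_max_left _ _, le_max_right _ _,
    ?_⟩, ⟨_, le_max_left _ _, le_max_right _ _, ?_⟩⟩
  · simpa using hn1
  · rw [mul_assoc] at hB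
    rwa [mul_comm (ENNReal.ofReal _) K, mul_comm (n : ℝ) B]
  · rw [mul_one_div_cancel hn.ne', ← mul_assoc]
    exact hn2

section Growth

variable {V : Type*} {Γ : SimpleGraph V}

theorem omegaLength_eq_sum_edgeList (ω : Config Γ) {x y : V} (p : Γ.Walk x y) :
    omegaLength ω p = ((edgeList p).map ω).sum := by
  rw [omegaLength, edgeList, List.map_map]
  rfl

theorem length_edgeList {x y : V} (p : Γ.Walk x y) : (edgeList p).length = p.length := by
  simp [edgeList]

theorem nodup_edgeList {x y : V} {p : Γ.Walk x y} (hp : p.IsPath) : (edgeList p).Nodup := by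
  refine List.Nodup.of_map Subtype.val ?_
  rw [edgeList, List.map_map]
  exact hp.isTrail.edges_nodup

theorem dist_le_of_mem_edgeList (hc : Γ.Connected) {q y : V} {p : Γ.Walk q y} {e : Γ.edgeSet}
    (he : e ∈ edgeList p) {v : V} (hv : v ∈ (e : Sym2 V)) (o : V) :
    Γ.dist v o ≤ Γ.dist q o + p.length := by
  classical
  obtain ⟨d, hd, rfl⟩ := List.mem_map.1 he
  have hz : v ∈ p.support := by
    rcases Sym2.mem_iff.1 hv with rfl | rfl
    · exact p.dart_fst_mem_support_of_mem_darts hd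
    · exact p.dart_snd_mem_support_of_mem_darts hd
  have h1 := SimpleGraph.dist_le (p.takeUntil v hz)
  have h2 := p.length_takeUntil_le_length hz
  have h3 := hc.dist_triangle (u := v) (v := q) (w := o)
  rw [Γ.dist_comm (u := v) (v := q)] at h3
  omega

theorem omegaLength_congr {ω ω' : Config Γ} {x y : V} (p : Γ.Walk x y)
    (h : ∀ e ∈ edgeList p, ω e = ω' e) : omegaLength ω p = omegaLength ω' p := by
  rw [omegaLength_eq_sum_edgeList, omegaLength_eq_sum_edgeList, List.map_congr_left h]

theorem measurable_override (S : Set Γ.edgeSet) (a : ℝ≥0) :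
    Measurable (override S a : Config Γ → Config Γ) := by
  classical
  refine measurable_pi_iff.2 fun e => ?_
  by_cases he : e ∈ S
  · simp only [override, he, if_true]
    exact measurable_const
  · simp only [override, he, if_false]
    exact measurable_pi_apply e

theorem measurable_omegaLength {x y : V} (p : Γ.Walk x y) :
    Measurable fun ω : Config Γ => omegaLength ω p := by
  induction p with
  | nil => simp
  | cons h p ih =>
    simp only [omegaLength_cons]
    exact (measurable_pi_apply _).add ih

variable {ρ : Measure ℝ≥0} [IsProbabilityMeasure ρ] {D : ℕ} {a₀ b₁ : ℝ≥0} {l c B : ℝ}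

theorem measure_omegaLength_override_ge_le {K : ℝ≥0∞} (S : Set Γ.edgeSet) (b : ℝ≥0) (k : ℝ)
    (hρ : ∫⁻ t : ℝ≥0, ENNReal.ofReal (Real.exp (k * t)) ∂ρ ≤ K)
    (hb : ENNReal.ofReal (Real.exp (k * b)) ≤ K) {x y : V} {τ : Γ.Walk x y} (hτ : τ.IsPath)
    (z : ℝ) :
    configMeasure Γ ρ {ω | z ≤ k * omegaLength (override S b ω) τ} ≤
      ENNReal.ofReal (Real.exp (-z)) * K ^ τ.length := by
  classical
  have h := measure_le_sum_le_exp_mul_pow (ρ := ρ)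
    (fun (e : Γ.edgeSet) (t : ℝ≥0) => k * ((if e ∈ S then b else t : ℝ≥0) : ℝ)) (fun e => by
      by_cases he : e ∈ S
      · simp only [he, if_true]; exact measurable_const
      · simp only [he, if_false]; fun_prop) (K := K) (fun e => by
      by_cases he : e ∈ S
      · simp only [he, if_true, lintegral_const, measure_univ, mul_one]; exact hb
      · simpa only [he, if_false] using hρ) (nodup_edgeList hτ) z
  rw [length_edgeList] at h
  have hsum : ∀ ω : Config Γ, k * (omegaLength (override S b ω) τ : ℝ) =
      ((edgeList τ).map fun e => k * ((if e ∈ S then b else ω e : ℝ≥0) : ℝ)).sum := fun ω => by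
    rw [List.sum_map_mul_left, omegaLength_eq_sum_edgeList, NNReal.coe_list_sum, List.map_map]
    rfl
  simp only [hsum]
  exact h

theorem IsGrowthRate.measure_not_growthCondition_le (h : IsGrowthRate ρ D a₀ b₁ l c B)
    (S : Set Γ.edgeSet) {x y : V} {τ : Γ.Walk x y} (hτ : τ.IsPath) (t : ℝ) :
    (D : ℝ≥0∞) ^ τ.length * configMeasure Γ ρ
      {ω | ¬ GrowthCondition (override S a₀ ω) (override S b₁ ω) c B t τ} ≤
      ENNReal.ofReal (Real.exp (-(l * t))) * (2 * 4⁻¹ ^ τ.length) := by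
  obtain ⟨K₁, hK₁, hb₁, hu⟩ := h.upper
  obtain ⟨K₂, hK₂, ha₀, hl⟩ := h.lower
  have h1 := measure_omegaLength_override_ge_le S b₁ l hK₁ hb₁ hτ (l * (B * τ.length + t))
  have h2 := measure_omegaLength_override_ge_le S a₀ (-l) (by simpa only [neg_mul] using hK₂)
    (by simpa only [neg_mul] using ha₀) hτ (-(l * (c * τ.length - t)))
  have hsub : {ω : Config Γ | ¬ GrowthCondition (override S a₀ ω) (override S b₁ ω) c B t τ} ⊆
      {ω | l * (B * τ.length + t) ≤ l * omegaLength (override S b₁ ω) τ} ∪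
      {ω | -(l * (c * τ.length - t)) ≤ -l * omegaLength (override S a₀ ω) τ} := by
    intro ω hω
    simp only [GrowthCondition, Set.mem_ofPred_eq, not_and_or, not_le] at hω
    rcases hω with hω | hω
    · right
      have := mul_le_mul_of_nonneg_left hω.le h.l_pos.le
      simp only [Set.mem_ofPred_eq]
      linarith
    · left
      exact mul_le_mul_of_nonneg_left hω.le h.l_pos.le
  have e1 : ENNReal.ofReal (Real.exp (-(l * (B * τ.length + t)))) =
      ENNReal.ofReal (Real.exp (-(l * t))) * ENNReal.ofReal (Real.exp (-(l * B))) ^ τ.length := by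
    rw [← ENNReal.ofReal_pow (Real.exp_pos _).le, ← ENNReal.ofReal_mul (Real.exp_pos _).le,
      ← Real.exp_nat_mul, ← Real.exp_add]
    congr 2
    ring
  have e2 : ENNReal.ofReal (Real.exp (- -(l * (c * τ.length - t)))) =
      ENNReal.ofReal (Real.exp (-(l * t))) * ENNReal.ofReal (Real.exp (l * c)) ^ τ.length := by
    rw [← ENNReal.ofReal_pow (Real.exp_pos _).le, ← ENNReal.ofReal_mul (Real.exp_pos _).le,
      ← Real.exp_nat_mul, ← Real.exp_add]
    congr 2
    ring
  rw [e1] at h1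
  rw [e2] at h2
  calc (D : ℝ≥0∞) ^ τ.length * configMeasure Γ ρ
        {ω | ¬ GrowthCondition (override S a₀ ω) (override S b₁ ω) c B t τ}
      ≤ (D : ℝ≥0∞) ^ τ.length * (ENNReal.ofReal (Real.exp (-(l * t))) *
          ENNReal.ofReal (Real.exp (-(l * B))) ^ τ.length * K₁ ^ τ.length +
          ENNReal.ofReal (Real.exp (-(l * t))) *
          ENNReal.ofReal (Real.exp (l * c)) ^ τ.length * K₂ ^ τ.length) := by
        gcongr
        exact (measure_mono hsub).trans ((measure_union_le _ _).trans (add_le_add h1 h2))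
    _ = ENNReal.ofReal (Real.exp (-(l * t))) *
          ((D * (ENNReal.ofReal (Real.exp (-(l * B))) * K₁)) ^ τ.length +
          (D * (ENNReal.ofReal (Real.exp (l * c)) * K₂)) ^ τ.length) := by
        simp only [mul_pow]
        ring
    _ ≤ ENNReal.ofReal (Real.exp (-(l * t))) * (4⁻¹ ^ τ.length + 4⁻¹ ^ τ.length) := by
        gcongr
    _ = _ := by rw [two_mul]

/-- The growth condition fails for some path starting at `q`, with
`dist q p` plus the number of edges at least `T`. -/
def growthFailure (Γ : SimpleGraph V) (S : Set Γ.edgeSet) (a₀ b₁ : ℝ≥0) (c B R : ℝ) (p : V)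
    (T : ℕ) : Set (Config Γ) :=
  {ω | ∃ (q y : V) (τ : Γ.Walk q y), τ.IsPath ∧ T ≤ Γ.dist q p + τ.length ∧
    ¬ GrowthCondition (override S a₀ ω) (override S b₁ ω) c B (R + Γ.dist q p) τ}

/-- Union bound over the starting point `q` and over the path. There are at most `D ^ r` choices for
`q` at distance `r` from `p`, and the error term `dist q p` in the growth condition compensates
for them. -/
theorem IsGrowthRate.measure_growthFailure_le [Γ.LocallyFinite] (hc : Γ.Connected)
    (h : IsGrowthRate ρ D a₀ b₁ l c B) (hD : ∀ v, Γ.degree v ≤ D) (S : Set Γ.edgeSet) (R : ℝ)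
    (p : V) (T : ℕ) :
    configMeasure Γ ρ (growthFailure Γ S a₀ b₁ c B R p T) ≤
      ENNReal.ofReal (Real.exp (-(l * R))) * 8 * 2⁻¹ ^ T := by
  set ν := configMeasure Γ ρ with hν
  let bad : ∀ (r : ℕ) {q : V}, (Σ y, Γ.Walk q y) → Set (Config Γ) := fun r q w =>
    {ω | w.2.IsPath ∧ ¬ GrowthCondition (override S a₀ ω) (override S b₁ ω) c B (R + r) w.2}
  let U : ℕ → ℕ → Set (Config Γ) := fun r n =>
    {ω | T ≤ r + n} ∩ ⋃ v ∈ walksFrom Γ r p, ⋃ w ∈ walksFrom Γ n v.1, bad r w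
  have hsub : growthFailure Γ S a₀ b₁ c B R p T ⊆ ⋃ r, ⋃ n, U r n := by
    rintro ω ⟨q, y, τ, hτ, hT, hbad⟩
    obtain ⟨g, hg⟩ := exists_isWordGeodesic hc p q
    have hg' : g.length = Γ.dist q p := by rw [SimpleGraph.dist_comm]; exact hg
    refine Set.mem_iUnion.2 ⟨Γ.dist q p, Set.mem_iUnion.2 ⟨τ.length, hT, ?_⟩⟩
    refine Set.mem_biUnion (x := ⟨q, g⟩) (hg' ▸ mem_walksFrom g) ?_
    exact Set.mem_biUnion (x := ⟨y, τ⟩) (mem_walksFrom τ) ⟨hτ, hbad⟩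
  have hbad : ∀ (r n : ℕ) (q : V), ∀ w ∈ walksFrom Γ n q, (D : ℝ≥0∞) ^ n * ν (bad r w) ≤
      ENNReal.ofReal (Real.exp (-(l * (R + r)))) * (2 * 4⁻¹ ^ n) := by
    intro r n q w hw
    rw [← length_eq_of_mem_walksFrom hw]
    by_cases hp : w.2.IsPath
    · simpa only [bad, hp, true_and] using h.measure_not_growthCondition_le S hp (R + r)
    · have : bad r w = ∅ := by ext; simp [bad, hp]
      simp [this]
  have hU : ∀ r n, ν (U r n) ≤
      ENNReal.ofReal (Real.exp (-(l * R))) * 2 * 2⁻¹ ^ T * (2⁻¹ ^ r * 2⁻¹ ^ n) := by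
    intro r n
    by_cases hT : T ≤ r + n
    · have h1 : ν (U r n) ≤ ∑ v ∈ walksFrom Γ r p, ∑ w ∈ walksFrom Γ n v.1, ν (bad r w) :=
        (measure_mono Set.inter_subset_right).trans ((measure_biUnion_finset_le _ _).trans
          (Finset.sum_le_sum fun v _ => measure_biUnion_finset_le _ _))
      have h2 : ∀ q : V, ∑ w ∈ walksFrom Γ n q, ν (bad r w) ≤
          ENNReal.ofReal (Real.exp (-(l * (R + r)))) * (2 * 4⁻¹ ^ n) := by
        intro q
        rcases Nat.eq_zero_or_pos (walksFrom Γ n q).card with h0 | h0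
        · rw [Finset.card_eq_zero.1 h0]; simp
        · have hDn : (D : ℝ≥0∞) ^ n ≠ 0 := by
            have := h0.trans_le (card_walksFrom_le hD n q)
            exact_mod_cast this.ne'
          have hDt : (D : ℝ≥0∞) ^ n ≠ ∞ := ENNReal.pow_ne_top (ENNReal.natCast_ne_top D)
          have h3 : ∀ w ∈ walksFrom Γ n q, ν (bad r w) ≤ ((D : ℝ≥0∞) ^ n)⁻¹ *
              (ENNReal.ofReal (Real.exp (-(l * (R + r)))) * (2 * 4⁻¹ ^ n)) := fun w hw => by
            rw [← ENNReal.mul_le_iff_le_inv hDn hDt]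
            exact hbad r n q w hw
          refine (Finset.sum_le_card_nsmul _ _ _ h3).trans ?_
          rw [nsmul_eq_mul, ← mul_assoc]
          have h4 : ((walksFrom Γ n q).card : ℝ≥0∞) ≤ (D : ℝ≥0∞) ^ n := by
            exact_mod_cast card_walksFrom_le hD n q
          calc ((walksFrom Γ n q).card : ℝ≥0∞) * ((D : ℝ≥0∞) ^ n)⁻¹ * _
              ≤ (D : ℝ≥0∞) ^ n * ((D : ℝ≥0∞) ^ n)⁻¹ *
                (ENNReal.ofReal (Real.exp (-(l * (R + r)))) * (2 * 4⁻¹ ^ n)) := by gcongr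
            _ = _ := by rw [ENNReal.mul_inv_cancel hDn hDt, one_mul]
      have h5 : ENNReal.ofReal (Real.exp (-(l * (R + r)))) =
          ENNReal.ofReal (Real.exp (-(l * R))) * ENNReal.ofReal (Real.exp (-l)) ^ r := by
        rw [← ENNReal.ofReal_pow (Real.exp_pos _).le, ← ENNReal.ofReal_mul (Real.exp_pos _).le,
          ← Real.exp_nat_mul, ← Real.exp_add]
        congr 2
        ring
      have h6 : (4⁻¹ : ℝ≥0∞) = 2⁻¹ * 2⁻¹ := by
        rw [← ENNReal.mul_inv (by simp) (by simp)]
        norm_num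
      have h7 : (2⁻¹ : ℝ≥0∞) ^ (r + n) ≤ 2⁻¹ ^ T :=
        pow_le_pow_right_of_le_one' (by simp) hT
      calc ν (U r n) ≤ ∑ v ∈ walksFrom Γ r p,
            ENNReal.ofReal (Real.exp (-(l * (R + r)))) * (2 * 4⁻¹ ^ n) :=
            h1.trans (Finset.sum_le_sum fun v _ => h2 v.1)
        _ ≤ (D : ℝ≥0∞) ^ r * (ENNReal.ofReal (Real.exp (-(l * (R + r)))) * (2 * 4⁻¹ ^ n)) := by
            rw [Finset.sum_const, nsmul_eq_mul]
            gcongr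
            exact_mod_cast card_walksFrom_le hD r p
        _ = ENNReal.ofReal (Real.exp (-(l * R))) * 2 *
            ((D * ENNReal.ofReal (Real.exp (-l))) ^ r * 4⁻¹ ^ n) := by
            rw [h5, mul_pow]; ring
        _ ≤ ENNReal.ofReal (Real.exp (-(l * R))) * 2 * (4⁻¹ ^ r * 4⁻¹ ^ n) := by
            gcongr
            exact h.decay
        _ = ENNReal.ofReal (Real.exp (-(l * R))) * 2 * 2⁻¹ ^ (r + n) * (2⁻¹ ^ r * 2⁻¹ ^ n) := by
            rw [h6, mul_pow, mul_pow, pow_add]; ring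
        _ ≤ _ := by gcongr
    · have : U r n = ∅ := by ext; simp [U, hT]
      simp [this]
  calc ν (growthFailure Γ S a₀ b₁ c B R p T) ≤ ∑' r, ∑' n, ν (U r n) :=
        (measure_mono hsub).trans ((measure_iUnion_le _).trans
          (ENNReal.tsum_le_tsum fun r => measure_iUnion_le _))
    _ ≤ ∑' r : ℕ, ∑' n : ℕ, ENNReal.ofReal (Real.exp (-(l * R))) * 2 * 2⁻¹ ^ T *
        (2⁻¹ ^ r * 2⁻¹ ^ n) := ENNReal.tsum_le_tsum fun r => ENNReal.tsum_le_tsum fun n => hU r n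
    _ = ENNReal.ofReal (Real.exp (-(l * R))) * 8 * 2⁻¹ ^ T := by
        simp only [ENNReal.tsum_mul_left, ENNReal.tsum_mul_right, ENNReal.tsum_geometric,
          ENNReal.one_sub_inv_two, inv_inv]
        ring

/-- The growth condition holds for all the paths that start at some `q`, with
`dist q p` plus the number of edges less than `T`. -/
def growthEvent (Γ : SimpleGraph V) (S : Set Γ.edgeSet) (a₀ b₁ : ℝ≥0) (c B R : ℝ) (p : V)
    (T : ℕ) : Set (Config Γ) :=
  {ω | ∀ (q y : V) (τ : Γ.Walk q y), τ.IsPath → Γ.dist q p + τ.length < T →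
    GrowthCondition (override S a₀ ω) (override S b₁ ω) c B (R + Γ.dist q p) τ}

theorem dependsOnCoords_growthEvent (hc : Γ.Connected) (S : Set Γ.edgeSet) (R : ℝ) (p : V)
    (T : ℕ) :
    DependsOnCoords (growthEvent Γ S a₀ b₁ c B R p T) (nearEdges Γ p T \ S) := by
  classical
  intro ω ω' hωω hω q y τ hτ hT
  have h := hω q y τ hτ hT
  have key : ∀ a : ℝ≥0, omegaLength (override S a ω) τ = omegaLength (override S a ω') τ := by
    refine fun a => omegaLength_congr τ fun e he => ?_
    by_cases heS : e ∈ S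
    · simp [override, heS]
    · simp only [override, heS, if_false]
      refine hωω e ⟨fun v hv => ?_, heS⟩
      have := dist_le_of_mem_edgeList hc he hv p
      omega
  unfold GrowthCondition at *
  rwa [← key a₀, ← key b₁]

theorem measurableSet_growthEvent [Γ.LocallyFinite] (hc : Γ.Connected) (S : Set Γ.edgeSet)
    (R : ℝ) (p : V) (T : ℕ) : MeasurableSet (growthEvent Γ S a₀ b₁ c B R p T) := by
  have := countable_of_connected hc
  have hset : growthEvent Γ S a₀ b₁ c B R p T = ⋂ q : V, ⋂ w : (Σ y, Γ.Walk q y),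
      {ω | w.2.IsPath → Γ.dist q p + w.2.length < T →
        GrowthCondition (override S a₀ ω) (override S b₁ ω) c B (R + Γ.dist q p) w.2} := by
    ext ω
    simp only [growthEvent, Set.mem_ofPred_eq, Set.mem_iInter]
    exact ⟨fun h q w => h q w.1 w.2, fun h q y τ => h q ⟨y, τ⟩⟩
  rw [hset]
  refine MeasurableSet.iInter fun q => ?_
  have := countable_walk (Γ := Γ) q
  refine MeasurableSet.iInter fun w => MeasurableSet.imp (.const _) (MeasurableSet.imp (.const _) ?_)
  have hm : ∀ a : ℝ≥0, Measurable fun ω : Config Γ => (omegaLength (override S a ω) w.2 : ℝ) :=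
    fun a => measurable_coe_nnreal_real.comp
      ((measurable_omegaLength w.2).comp (measurable_override S a))
  exact (measurableSet_le measurable_const ((hm a₀).add_const _)).inter
    (measurableSet_le (hm b₁) measurable_const)

end Growth

/-! ### Corridors occur infinitely often -/

section Recurrence

variable {V : Type*} {Γ : SimpleGraph V} {ρ : Measure ℝ≥0} [IsProbabilityMeasure ρ]
  {D : ℕ} {a₀ a₁ b₀ b₁ : ℝ≥0} {l c B : ℝ}

/-- The number of edges in a ball of radius `M` is bounded in terms of `M` and `D`. -/
theorem exists_finset_nearEdges [Γ.LocallyFinite] (hc : Γ.Connected) (hD : ∀ v, Γ.degree v ≤ D)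
    (p : V) (M : ℕ) : ∃ F : Finset Γ.edgeSet, (F : Set Γ.edgeSet) = nearEdges Γ p M ∧
      F.card ≤ (∑ r ∈ Finset.range (M + 1), D ^ r + 1).choose 2 := by
  classical
  obtain ⟨B, hB, hcard⟩ := exists_ball_subset_finset hc hD p M
  have hsub : Subtype.val '' nearEdges Γ p M ⊆ (B.sym2 : Set (Sym2 V)) := by
    rintro _ ⟨e, he, rfl⟩
    rw [Finset.mem_coe, Finset.mem_sym2_iff]
    exact fun v hv => hB v (he v hv)
  have hfin : (nearEdges Γ p M).Finite :=
    Set.Finite.of_finite_image (B.sym2.finite_toSet.subset hsub) Subtype.val_injective.injOn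
  refine ⟨hfin.toFinset, hfin.coe_toFinset, ?_⟩
  calc hfin.toFinset.card = (hfin.toFinset.image Subtype.val).card :=
        (Finset.card_image_of_injective _ Subtype.val_injective).symm
    _ ≤ B.sym2.card := Finset.card_le_card fun e he => by
        obtain ⟨f, hf, rfl⟩ := Finset.mem_image.1 he
        exact hsub ⟨f, (hfin.mem_toFinset.1 hf), rfl⟩
    _ ≤ _ := by
        rw [Finset.card_sym2]
        exact Nat.choose_le_choose 2 (Nat.add_le_add_right hcard 1)

theorem dependsOnCoords_hasCorridor (N M : ℕ) (s : ℕ → V) :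
    DependsOnCoords {ω : Config Γ | HasCorridor ω a₀ a₁ b₀ b₁ N M s} (nearEdges Γ (s N) M) := by
  intro ω ω' h hω e he
  rw [← h e he]
  exact hω e he

open Classical in
theorem hasCorridor_iff_mem_pi {F : Finset Γ.edgeSet} {N M : ℕ} {s : ℕ → V}
    (hF : (F : Set Γ.edgeSet) = nearEdges Γ (s N) M) :
    {ω : Config Γ | HasCorridor ω a₀ a₁ b₀ b₁ N M s} = Set.pi (F : Set Γ.edgeSet) fun e =>
      if IsSegmentEdge (2 * N) s e then Set.Icc a₀ a₁ else Set.Icc b₀ b₁ := by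
  ext ω
  simp only [HasCorridor, Set.mem_ofPred_eq, Set.mem_pi, hF]
  refine forall₂_congr fun e _ => ?_
  by_cases h : IsSegmentEdge (2 * N) s e <;> simp [h]

theorem measurableSet_hasCorridor [Γ.LocallyFinite] (hc : Γ.Connected)
    (hD : ∀ v, Γ.degree v ≤ D) (N M : ℕ) (s : ℕ → V) :
    MeasurableSet {ω : Config Γ | HasCorridor ω a₀ a₁ b₀ b₁ N M s} := by
  classical
  obtain ⟨F, hF, -⟩ := exists_finset_nearEdges hc hD (s N) M
  rw [hasCorridor_iff_mem_pi hF]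
  refine MeasurableSet.pi F.countable_toSet fun e _ => ?_
  split_ifs <;> exact measurableSet_Icc

theorem pow_le_measure_hasCorridor [Γ.LocallyFinite] (hc : Γ.Connected)
    (hD : ∀ v, Γ.degree v ≤ D) {r : ℝ≥0∞} (ha : r ≤ ρ (Set.Icc a₀ a₁)) (hb : r ≤ ρ (Set.Icc b₀ b₁))
    (N M : ℕ) (s : ℕ → V) :
    r ^ (∑ r ∈ Finset.range (M + 1), D ^ r + 1).choose 2 ≤
      configMeasure Γ ρ {ω | HasCorridor ω a₀ a₁ b₀ b₁ N M s} := by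
  classical
  obtain ⟨F, hF, hcard⟩ := exists_finset_nearEdges hc hD (s N) M
  rw [hasCorridor_iff_mem_pi hF, configMeasure, Measure.infinitePi_pi _ (fun e _ => by
    split_ifs <;> exact measurableSet_Icc)]
  calc r ^ (∑ r ∈ Finset.range (M + 1), D ^ r + 1).choose 2 ≤ r ^ F.card :=
        pow_le_pow_right_of_le_one' (ha.trans prob_le_one) hcard
    _ = ∏ _e ∈ F, r := by rw [Finset.prod_const]
    _ ≤ _ := Finset.prod_le_prod' fun e _ => by split_ifs <;> assumption

/-- In the corridor event the weights near the corridor lie between the constants used in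
`growthEvent`, hence the growth conditions hold for the weights themselves. -/
theorem HasCorridor.hasLinearGrowth {ω : Config Γ} {N M : ℕ} {s : ℕ → V} {R : ℝ} {T : ℕ}
    (hcor : HasCorridor ω a₀ a₁ b₀ b₁ N M s) (ha : a₀ ≤ a₁) (hab : a₁ < b₀) (hb : b₀ ≤ b₁)
    (h₁ : ω ∈ growthEvent Γ (nearEdges Γ (s N) M) a₀ b₁ c B R (s N) T)
    (h₂ : ω ∉ growthFailure Γ (nearEdges Γ (s N) M) a₀ b₁ c B R (s N) T) :
    HasLinearGrowth ω c B R (s N) := by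
  classical
  have hlow : override (nearEdges Γ (s N) M) a₀ ω ≤ ω := fun e => by
    by_cases he : e ∈ nearEdges Γ (s N) M
    · simp only [override, he, if_true]
      by_cases hs : IsSegmentEdge (2 * N) s e
      · exact ((hcor e he).1 hs).1
      · exact (ha.trans hab.le).trans ((hcor e he).2 hs).1
    · simp [override, he]
  have hup : ω ≤ override (nearEdges Γ (s N) M) b₁ ω := fun e => by
    by_cases he : e ∈ nearEdges Γ (s N) M
    · simp only [override, he, if_true]
      by_cases hs : IsSegmentEdge (2 * N) s e
      · exact (((hcor e he).1 hs).2.trans hab.le).trans hb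
      · exact ((hcor e he).2 hs).2
    · simp [override, he]
  intro q y τ hτ
  have hg : GrowthCondition (override (nearEdges Γ (s N) M) a₀ ω)
      (override (nearEdges Γ (s N) M) b₁ ω) c B (R + Γ.dist q (s N)) τ := by
    by_cases hT : Γ.dist q (s N) + τ.length < T
    · exact h₁ q y τ hτ hT
    · by_contra hcon
      exact h₂ ⟨q, y, τ, hτ, not_lt.1 hT, hcon⟩
  have h3 : (omegaLength (override (nearEdges Γ (s N) M) a₀ ω) τ : ℝ) ≤ omegaLength ω τ := by
    exact_mod_cast omegaLength_mono hlow τ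
  have h4 : (omegaLength ω τ : ℝ) ≤ omegaLength (override (nearEdges Γ (s N) M) b₁ ω) τ := by
    exact_mod_cast omegaLength_mono hup τ
  exact ⟨hg.1.trans (by linarith), h4.trans hg.2⟩

/-- The truncated corridor events around well-separated segments are independent and have
probabilities bounded below, and almost surely only finitely many of the complementary large-scale
failures occur. -/
theorem ae_frequently_hasCorridor [Γ.LocallyFinite] (hc : Γ.Connected)
    (hD : ∀ v, Γ.degree v ≤ D) (hrate : IsGrowthRate ρ D a₀ b₁ l c B)
    (ha : a₀ ≤ a₁) (hab : a₁ < b₀) (hb : b₀ ≤ b₁)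
    (hρa : ρ (Set.Icc a₀ a₁) ≠ 0) (hρb : ρ (Set.Icc b₀ b₁) ≠ 0)
    {R : ℝ} (hR : ENNReal.ofReal (Real.exp (-(l * R))) * 8 ≤ 2⁻¹) {N M : ℕ} {s : ℕ → ℕ → V}
    {T : ℕ → ℕ} (hMT : ∀ i, M ≤ T i) (hT : ∀ i, i ≤ T i)
    (hsep : ∀ i j, i ≠ j → T i + T j < Γ.dist (s i N) (s j N)) :
    ∀ᵐ ω ∂(configMeasure Γ ρ), ∃ᶠ i in atTop,
      HasCorridor ω a₀ a₁ b₀ b₁ N M (s i) ∧ HasLinearGrowth ω c B R (s i N) := by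
  have hprob : IsProbabilityMeasure (configMeasure Γ ρ) := by
    unfold configMeasure; infer_instance
  set ν := configMeasure Γ ρ with hν
  let S : ℕ → Set Γ.edgeSet := fun i => nearEdges Γ (s i N) M
  let E : ℕ → Set (Config Γ) := fun i => {ω | HasCorridor ω a₀ a₁ b₀ b₁ N M (s i)}
  let F : ℕ → Set (Config Γ) := fun i => growthEvent Γ (S i) a₀ b₁ c B R (s i N) (T i)
  have hEm : ∀ i, MeasurableSet (E i) := fun i => measurableSet_hasCorridor hc hD N M (s i)
  have hFm : ∀ i, MeasurableSet (F i) := fun i => measurableSet_growthEvent hc (S i) R _ _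
  have hEd : ∀ i, DependsOnCoords (E i) (S i) := fun i => dependsOnCoords_hasCorridor N M (s i)
  have hFd : ∀ i, DependsOnCoords (F i) (nearEdges Γ (s i N) (T i) \ S i) := fun i =>
    dependsOnCoords_growthEvent hc (S i) R _ _
  have hmono : ∀ i, S i ⊆ nearEdges Γ (s i N) (T i) := fun i e he v hv =>
    (he v hv).trans (hMT i)
  have hEF : ∀ i, DependsOnCoords (E i ∩ F i) (nearEdges Γ (s i N) (T i)) := fun i =>
    ((hEd i).inter (hFd i)).mono (Set.union_subset (hmono i) Set.sdiff_subset)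
  have hdisj : Pairwise fun i j => Disjoint (nearEdges Γ (s i N) (T i))
      (nearEdges Γ (s j N) (T j)) := by
    intro i j hij
    rw [Set.disjoint_left]
    intro e he he'
    obtain ⟨v, hv⟩ : ∃ v, v ∈ (e : Sym2 V) := ⟨_, (e : Sym2 V).out_fst_mem⟩
    have h1 := he v hv
    have h2 := he' v hv
    have h3 := hsep i j hij
    have h4 := hc.dist_triangle (u := s i N) (v := v) (w := s j N)
    rw [Γ.dist_comm (u := s i N) (v := v)] at h4
    omega
  have hind : iIndepSet (fun i => E i ∩ F i) ν :=
    iIndepSet_of_dependsOnCoords hEF hdisj fun i => (hEm i).inter (hFm i)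
  set r := min (ρ (Set.Icc a₀ a₁)) (ρ (Set.Icc b₀ b₁)) with hr
  set L := (∑ r ∈ Finset.range (M + 1), D ^ r + 1).choose 2 with hL
  have hr0 : r ≠ 0 := by
    rw [hr]
    exact (lt_min (pos_iff_ne_zero.2 hρa) (pos_iff_ne_zero.2 hρb)).ne'
  have hFp : ∀ i, 2⁻¹ ≤ ν (F i) := by
    intro i
    have h1 : (F i)ᶜ ⊆ growthFailure Γ (S i) a₀ b₁ c B R (s i N) 0 := by
      intro ω hω
      by_contra hcon
      refine hω fun q y τ hτ _ => ?_
      by_contra hg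
      exact hcon ⟨q, y, τ, hτ, Nat.zero_le _, hg⟩
    have h2 : ν (F i)ᶜ ≤ 2⁻¹ := (measure_mono h1).trans
      ((hrate.measure_growthFailure_le hc hD (S i) R (s i N) 0).trans (by simpa using hR))
    rw [prob_compl_eq_one_sub (hFm i)] at h2
    rw [tsub_le_iff_right] at h2
    have h3 : (2⁻¹ : ℝ≥0∞) + 2⁻¹ ≤ 2⁻¹ + ν (F i) := by rwa [ENNReal.inv_two_add_inv_two]
    exact (ENNReal.add_le_add_iff_left (by simp)).1 h3
  have hp : ∀ i, r ^ L * 2⁻¹ ≤ ν (E i ∩ F i) := by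
    intro i
    have : ν (E i ∩ F i) = ν (E i) * ν (F i) :=
      (hEd i).measure_inter (hFd i) Set.disjoint_sdiff_right (hEm i) (hFm i)
    rw [this]
    exact mul_le_mul' (pow_le_measure_hasCorridor hc hD (min_le_left _ _) (min_le_right _ _) N M _)
      (hFp i)
  have hsum : ∑' i, ν (E i ∩ F i) = ∞ := by
    refine top_le_iff.1 (le_trans (le_of_eq ?_) (ENNReal.tsum_le_tsum hp))
    refine (ENNReal.tsum_const_eq_top_of_ne_zero ?_).symm
    exact mul_ne_zero (pow_ne_zero _ hr0) (by simp)
  have hlim := measure_limsup_eq_one (fun i => (hEm i).inter (hFm i)) hind hsum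
  have hfreq : ∀ᵐ ω ∂ν, ∃ᶠ i in atTop, ω ∈ E i ∩ F i := by
    have hmeas : MeasurableSet (limsup (fun i => E i ∩ F i) atTop) :=
      MeasurableSet.measurableSet_limsup fun i => (hEm i).inter (hFm i)
    have h1 := (prob_compl_eq_zero_iff hmeas).2 hlim
    filter_upwards [compl_mem_ae_iff.2 h1] with ω hω
    rw [compl_compl] at hω
    exact mem_limsup_iff_frequently_mem.1 hω
  have htail : ∑' i, ν (growthFailure Γ (S i) a₀ b₁ c B R (s i N) (T i)) ≠ ∞ := by
    refine ne_top_of_le_ne_top ?_ (ENNReal.tsum_le_tsum (g := fun i : ℕ => 2⁻¹ ^ i) fun i => ?_)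
    · rw [ENNReal.tsum_geometric, ENNReal.one_sub_inv_two]
      simp
    · refine (hrate.measure_growthFailure_le hc hD (S i) R (s i N) (T i)).trans ?_
      calc ENNReal.ofReal (Real.exp (-(l * R))) * 8 * 2⁻¹ ^ T i ≤ 1 * 2⁻¹ ^ i := by
            refine mul_le_mul' (hR.trans (by simp)) ?_
            exact pow_le_pow_right_of_le_one' (by simp) (hT i)
        _ = 2⁻¹ ^ i := one_mul _
  filter_upwards [hfreq, ae_eventually_notMem htail] with ω hω hω'
  exact (hω.and_eventually hω').mono fun i hi =>
    ⟨hi.1.1, HasCorridor.hasLinearGrowth hi.1.1 ha hab hb hi.1.2 hi.2⟩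

end Recurrence

/-! ### Almost sure uniqueness of `ω`-geodesics -/

section Uniqueness

variable {V : Type*} {Γ : SimpleGraph V} {ρ : Measure ℝ≥0} [IsProbabilityMeasure ρ]

theorem exists_mem_edges_notMem_edges {x y : V} {p q : Γ.Walk x y} (hp : p.IsPath) (hq : q.IsPath)
    (hpq : p ≠ q) : ∃ e, (e ∈ p.edges ∧ e ∉ q.edges) ∨ (e ∈ q.edges ∧ e ∉ p.edges) := by
  induction p with
  | nil =>
    cases q with
    | nil => exact absurd rfl hpq
    | cons h' q => exact absurd q.end_mem_support ((SimpleGraph.Walk.cons_isPath_iff _ _).1 hq).2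
  | @cons u v w h p ih =>
    cases q with
    | nil => exact absurd p.end_mem_support ((SimpleGraph.Walk.cons_isPath_iff _ _).1 hp).2
    | @cons _ v' _ h' q =>
      rw [SimpleGraph.Walk.cons_isPath_iff] at hp hq
      have hnot : ∀ {a z : V} (r : Γ.Walk a w), u ∉ r.support → s(u, z) ∉ r.edges :=
        fun r hr he => hr (r.fst_mem_support_of_mem_edges he)
      by_cases hv : v = v'
      · subst hv
        obtain ⟨e, he⟩ := ih hp.1 hq.1 (fun h0 => hpq (by rw [h0]))
        have hne : ∀ {e : Sym2 V}, e ∈ p.edges ∨ e ∈ q.edges → e ≠ s(u, v) := by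
          rintro _ (he | he) rfl
          · exact hnot p hp.2 he
          · exact hnot q hq.2 he
        refine ⟨e, he.imp (fun h1 => ?_) (fun h1 => ?_)⟩
        · simp [h1.1, h1.2, hne (Or.inl h1.1)]
        · simp [h1.1, h1.2, hne (Or.inr h1.1)]
      · refine ⟨s(u, v), Or.inl ⟨by simp, ?_⟩⟩
        rw [SimpleGraph.Walk.edges_cons, List.mem_cons, not_or]
        exact ⟨fun h0 => hv (Sym2.congr_right.1 h0), hnot q hq.2⟩

/-- A weight without atoms almost surely differs from any function of the other weights. -/
theorem measure_coord_eq_zero {ι : Type*} (hatoms : ∀ t : ℝ≥0, ρ {t} = 0) (e : ι)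
    {f : (ι → ℝ≥0) → ℝ} (hf : Measurable f) :
    (Measure.infinitePi fun _ : ι => ρ) {ω | (ω e : ℝ) = f (cutoff {e}ᶜ ω)} = 0 := by
  set ν := Measure.infinitePi fun _ : ι => ρ with hν
  have hcut : ∀ U : Set ι, Measurable (cutoff U : (ι → ℝ≥0) → ι → ℝ≥0) := fun U => by
    refine measurable_pi_iff.2 fun i => ?_
    by_cases hi : i ∈ U
    · simp only [cutoff, Set.indicator_of_mem hi]; exact measurable_pi_apply i
    · simp only [cutoff, Set.indicator_of_notMem hi]; exact measurable_const
  have hπ : Measurable fun ω : ι → ℝ≥0 => ω e := measurable_pi_apply e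
  have hind := (indepFun_cutoff (ρ := ρ) (disjoint_compl_right (a := ({e} : Set ι)))).comp
    (φ := fun ω => ω e) (ψ := fun ω => f ω) hπ hf
  have hX : (fun ω : ι → ℝ≥0 => ω e) ∘ cutoff {e} = fun ω => ω e := by
    ext ω; simp [cutoff]
  rw [hX] at hind
  have hY : Measurable ((fun ω => f ω) ∘ cutoff ({e}ᶜ : Set ι)) := hf.comp (hcut _)
  have hmap := (indepFun_iff_map_prod_eq_prod_map_map hπ.aemeasurable
    hY.aemeasurable).1 hind
  have hdiag : MeasurableSet {z : ℝ≥0 × ℝ | (z.1 : ℝ) = z.2} :=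
    measurableSet_eq_fun (by fun_prop) (by fun_prop)
  have h1 : ν {ω | (ω e : ℝ) = f (cutoff {e}ᶜ ω)} =
      (ν.map fun ω => (ω e, ((fun ω => f ω) ∘ cutoff ({e}ᶜ : Set ι)) ω))
        {z : ℝ≥0 × ℝ | (z.1 : ℝ) = z.2} := by
    rw [Measure.map_apply (hπ.prodMk hY) hdiag]
    rfl
  have := Measure.isProbabilityMeasure_map (μ := ν) hY.aemeasurable
  have heval : ν.map (fun ω : ι → ℝ≥0 => ω e) = ρ :=
    (measurePreserving_eval_infinitePi (fun _ : ι => ρ) e).map_eq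
  rw [h1, hmap, heval, Measure.prod_apply_symm hdiag, lintegral_eq_zero_iff
    (measurable_measure_prodMk_right hdiag)]
  refine Eventually.of_forall fun t => ?_
  have hsub : (fun x : ℝ≥0 => (x, t)) ⁻¹' {z : ℝ≥0 × ℝ | (z.1 : ℝ) = z.2} ⊆ {t.toNNReal} := by
    intro x hx
    have : (x : ℝ) = t := hx
    simp [← this]
  exact measure_mono_null hsub (hatoms _)

theorem ae_omegaLength_ne_of_mem (hatoms : ∀ t : ℝ≥0, ρ {t} = 0) {x y : V} {p q : Γ.Walk x y}
    (hp : p.IsPath) {e : Γ.edgeSet} (hep : e ∈ edgeList p) (heq : e ∉ edgeList q) :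
    ∀ᵐ ω ∂(configMeasure Γ ρ), omegaLength ω p ≠ omegaLength ω q := by
  classical
  have h0 := measure_coord_eq_zero hatoms e
    (f := fun ω : Config Γ => (omegaLength ω q : ℝ) - (((edgeList p).erase e).map ω).sum) (by
      refine Measurable.sub ?_ ?_
      · exact measurable_coe_nnreal_real.comp (measurable_omegaLength q)
      · refine measurable_coe_nnreal_real.comp ?_
        induction (edgeList p).erase e with
        | nil => simp
        | cons a t ih => simpa using! (measurable_pi_apply a).add ih)
  rw [ae_iff]
  refine measure_mono_null (fun ω hω => ?_) h0
  simp only [Set.mem_ofPred_eq, ne_eq, not_not] at hω ⊢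
  have e1 : omegaLength (cutoff {e}ᶜ ω) q = omegaLength ω q :=
    omegaLength_congr q fun f hf => Set.indicator_of_mem (by
      rintro rfl
      exact heq hf) _
  have e2 : ((edgeList p).erase e).map (cutoff {e}ᶜ ω) = ((edgeList p).erase e).map ω :=
    List.map_congr_left fun f hf => Set.indicator_of_mem (by
      rintro rfl
      exact (nodup_edgeList hp).not_mem_erase hf) _
  have e3 : omegaLength ω p = ω e + (((edgeList p).erase e).map ω).sum := by
    rw [omegaLength_eq_sum_edgeList, ← List.sum_cons, ← List.map_cons]
    exact ((List.perm_cons_erase hep).map ω).sum_eq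
  rw [e1, e2, ← hω, e3]
  push_cast
  ring

theorem mem_edgeList {x y : V} {p : Γ.Walk x y} {e : Γ.edgeSet} :
    e ∈ edgeList p ↔ (e : Sym2 V) ∈ p.edges := by
  rw [edgeList, SimpleGraph.Walk.edges, List.mem_map, List.mem_map]
  exact exists_congr fun d => and_congr_right fun _ => Subtype.ext_iff

theorem ae_injective_omegaLength [Γ.LocallyFinite] (hc : Γ.Connected)
    (hatoms : ∀ t : ℝ≥0, ρ {t} = 0) :
    ∀ᵐ ω ∂(configMeasure Γ ρ), ∀ (x y : V) (p q : Γ.Walk x y), p.IsPath → q.IsPath →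
      omegaLength ω p = omegaLength ω q → p = q := by
  have := countable_of_connected hc
  have key : ∀ᵐ ω ∂(configMeasure Γ ρ), ∀ (x : V) (v w : Σ y, Γ.Walk x y) (h : v.1 = w.1),
      v.2.IsPath → w.2.IsPath → omegaLength ω v.2 = omegaLength ω w.2 →
      v.2.copy rfl h = w.2 := by
    refine ae_all_iff.2 fun x => ?_
    have := countable_walk (Γ := Γ) x
    refine ae_all_iff.2 fun v => ae_all_iff.2 fun w => ?_
    obtain ⟨y, p⟩ := v
    obtain ⟨y', q⟩ := w
    by_cases h : y = y'
    · subst h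
      by_cases hpq : p = q
      · subst hpq
        exact Eventually.of_forall fun ω _ _ _ _ => rfl
      · by_cases hp : p.IsPath
        · by_cases hq : q.IsPath
          · obtain ⟨e, he | he⟩ := exists_mem_edges_notMem_edges hp hq hpq
            · have heΓ := p.edges_subset_edgeSet he.1
              filter_upwards [ae_omegaLength_ne_of_mem (ρ := ρ) hatoms (q := q) hp (e := ⟨e, heΓ⟩)
                (mem_edgeList.2 he.1) fun h1 => he.2 (mem_edgeList.1 h1)] with ω hω
              exact fun _ _ _ h => absurd h hω
            · have heΓ := q.edges_subset_edgeSet he.1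
              filter_upwards [ae_omegaLength_ne_of_mem (ρ := ρ) hatoms (q := p) hq (e := ⟨e, heΓ⟩)
                (mem_edgeList.2 he.1) fun h1 => he.2 (mem_edgeList.1 h1)] with ω hω
              exact fun _ _ _ h => absurd h.symm hω
          · exact Eventually.of_forall fun ω _ _ h => absurd h hq
        · exact Eventually.of_forall fun ω _ h => absurd h hp
    · exact Eventually.of_forall fun ω h' => absurd h' h
  filter_upwards [key] with ω hω x y p q hp hq h
  exact hω x ⟨y, p⟩ ⟨y, q⟩ rfl hp hq h

theorem ae_weight_pos [Γ.LocallyFinite] (hc : Γ.Connected) (h0 : ρ {0} = 0) :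
    ∀ᵐ ω ∂(configMeasure Γ ρ), ∀ e : Γ.edgeSet, 0 < ω e := by
  have := countable_of_connected hc
  have : Countable (Sym2 V) := Quot.mk_surjective.countable
  refine ae_all_iff.2 fun e => ?_
  have h1 : ∀ᵐ t ∂ρ, 0 < t := by
    rw [ae_iff]
    simpa using h0
  exact (measurePreserving_eval_infinitePi (fun _ : Γ.edgeSet => ρ) e).quasiMeasurePreserving.ae h1

end Uniqueness

/-! ### Geodesics in configurations with positive weights and distinct path lengths -/

section Geodesics

variable {V : Type*} {Γ : SimpleGraph V} {ω : Config Γ}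

theorem IsOmegaGeodesic.isPath (hc : Γ.Connected) (hpos : ∀ e, 0 < ω e) {x y : V}
    {p : Γ.Walk x y} (hp : IsOmegaGeodesic ω p) : p.IsPath := by
  classical
  induction p with
  | nil => exact SimpleGraph.Walk.IsPath.nil
  | @cons u v w h p ih =>
    have hp' : IsOmegaGeodesic ω p :=
      IsOmegaGeodesic.of_append_right (p := SimpleGraph.Walk.cons h SimpleGraph.Walk.nil) hc hp
    refine (SimpleGraph.Walk.cons_isPath_iff h p).2 ⟨ih hp', fun hu => ?_⟩
    have h1 : omegaLength ω (SimpleGraph.Walk.cons h p) ≤ omegaLength ω (p.dropUntil u hu) := by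
      rw [hp]; exact passageTime_le _
    have h2 : omegaLength ω (p.dropUntil u hu) ≤ omegaLength ω p := by
      conv_rhs => rw [← p.take_spec hu, omegaLength_append]
      exact le_add_self
    rw [omegaLength_cons] at h1
    have h3 := hpos ⟨s(u, v), h⟩
    have h4 : ω ⟨s(u, v), h⟩ + omegaLength ω p ≤ 0 + omegaLength ω p := by
      rw [zero_add]; exact h1.trans h2
    exact absurd (le_of_add_le_add_right h4) (not_le.2 h3)

/-- Linear growth makes the infimum defining the passage time a minimum over finitely many
paths. -/
theorem HasLinearGrowth.exists_isOmegaGeodesic [Γ.LocallyFinite] (hc : Γ.Connected)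
    {c B R : ℝ} {p : V} (h : HasLinearGrowth ω c B R p) (hcpos : 0 < c) (x y : V) :
    ∃ q : Γ.Walk x y, IsOmegaGeodesic ω q := by
  classical
  obtain ⟨g, -⟩ := exists_isWordGeodesic hc x y
  obtain ⟨n, hn⟩ := exists_nat_gt ((omegaLength ω g + (R + Γ.dist x p)) / c)
  rw [div_lt_iff₀ hcpos] at hn
  let F : Finset (Σ y, Γ.Walk x y) :=
    (insert ⟨y, g⟩ ((Finset.range n).biUnion fun m => walksFrom Γ m x)).filter fun w => w.1 = y
  have hg : (⟨y, g⟩ : Σ y, Γ.Walk x y) ∈ F := by simp [F]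
  obtain ⟨⟨y', q⟩, hq, hmin⟩ := F.exists_min_image (fun w => omegaLength ω w.2) ⟨_, hg⟩
  obtain rfl : y' = y := (Finset.mem_filter.1 hq).2
  refine ⟨q, le_antisymm (le_passageTime hc fun r => ?_) (FPP.passageTime_le _)⟩
  refine le_trans ?_ (omegaLength_bypass_le r)
  rcases le_total (omegaLength ω g) (omegaLength ω r.bypass) with h1 | h1
  · exact (hmin _ hg).trans h1
  · refine hmin ⟨y', r.bypass⟩ (Finset.mem_filter.2 ⟨Finset.mem_insert_of_mem
      (Finset.mem_biUnion.2 ⟨r.bypass.length, ?_, mem_walksFrom _⟩), rfl⟩)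
    have h2 := (h x y' r.bypass r.bypass_isPath).1
    have h3 : (omegaLength ω r.bypass : ℝ) ≤ omegaLength ω g := by exact_mod_cast h1
    have h4 : c * r.bypass.length < n * c := by linarith
    rw [mul_comm, mul_lt_mul_iff_left₀ hcpos] at h4
    exact Finset.mem_range.2 (by exact_mod_cast h4)

/-- Being an `ω`-geodesic only depends on the sequence of vertices. -/
theorem IsOmegaGeodesic.congr {a b a' b' : V} {p : Γ.Walk a b} {q : Γ.Walk a' b'}
    (hp : IsOmegaGeodesic ω p) (hlen : p.length = q.length)
    (hv : ∀ t ≤ p.length, p.getVert t = q.getVert t) : IsOmegaGeodesic ω q := by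
  obtain rfl : a = a' := by simpa using hv 0 (Nat.zero_le _)
  obtain rfl : b = b' := by
    have := hv p.length le_rfl
    rwa [p.getVert_length, hlen, q.getVert_length] at this
  obtain rfl : p = q := SimpleGraph.Walk.ext_getVert_le_length hlen hv
  exact hp

variable {γ : ℕ → V} (h : ∀ k, Γ.Adj (γ k) (γ (k + 1)))

@[simp]
theorem length_segment (i n : ℕ) : (segment γ h i n).length = n := by
  induction n with
  | zero => rfl
  | succ n ih => rw [segment, SimpleGraph.Walk.length_concat, ih]

theorem getVert_segment (i n : ℕ) {t : ℕ} (ht : t ≤ n) :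
    (segment γ h i n).getVert t = γ (i + t) := by
  induction n with
  | zero =>
    obtain rfl : t = 0 := by omega
    rfl
  | succ n ih =>
    rw [segment, SimpleGraph.Walk.concat_eq_append, SimpleGraph.Walk.getVert_append]
    rw [length_segment]
    by_cases hlt : t < n
    · rw [if_pos hlt]
      exact ih hlt.le
    · rw [if_neg hlt]
      rcases Nat.le_or_eq_of_le_succ ht with h1 | h1
      · obtain rfl : t = n := by omega
        simp
      · subst h1
        simp

theorem IsOmegaGeodesicRay.shift (hγ : IsOmegaGeodesicRay Γ ω γ) (m : ℕ) :
    IsOmegaGeodesicRay Γ ω fun k => γ (m + k) := by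
  obtain ⟨h, hgeo⟩ := hγ
  refine ⟨fun k => h (m + k), fun i n => (hgeo (m + i) n).congr (by simp) fun t ht => ?_⟩
  rw [length_segment] at ht
  rw [getVert_segment _ _ _ ht, getVert_segment (γ := fun k => γ (m + k)) _ _ _ ht, add_assoc]

end Geodesics

/-! ### Rays through cut vertices -/

/-- Every `ω`-geodesic from a vertex `x` with `⟨x, z⟩_o < lo` to a vertex `y` with `⟨y, z⟩_o > hi`
passes through `v`. -/
def IsCut {V : Type*} {Γ : SimpleGraph V} (ω : Config Γ) (o z v : V) (lo hi : ℝ) : Prop :=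
  ∀ (x y : V) (σ : Γ.Walk x y), IsOmegaGeodesic ω σ → σ.IsPath → gromovProduct Γ o x z < lo →
    hi < gromovProduct Γ o y z → v ∈ σ.support

/-- The vertices `v i` go to infinity in the direction of the sequence `x`. Each of them comes with a
reference vertex `z i`, far away in this direction, and two thresholds: the vertices with Gromov
product with `z i` less than `lo i` are behind `v i`, those with product more than `hi i` are
ahead of it. The constant `κ` is the one of the four-point inequality. -/
structure IsMarkerSequence {V : Type*} (Γ : SimpleGraph V) (o : V) (x : ℕ → V) (κ : ℝ)
    (v z : ℕ → V) (lo hi : ℕ → ℝ) : Prop where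
  four_point : ∀ a b c : V, min (gromovProduct Γ o a b) (gromovProduct Γ o b c) - κ ≤
    gromovProduct Γ o a c
  lo_le_hi : ∀ i, lo i ≤ hi i
  reference : ∀ i, ∀ᶠ m in atTop, hi i + 2 * κ < gromovProduct Γ o (z i) (x m)
  ahead : ∀ i j, i < j → ∀ᶠ m in atTop, hi i + κ < gromovProduct Γ o (v j) (x m)
  not_behind : ∀ i, lo i ≤ gromovProduct Γ o (v i) (z i)
  tendsto_lo : Tendsto lo atTop atTop
  κ_nonneg : 0 ≤ κ

namespace IsMarkerSequence

variable {V : Type*} {Γ : SimpleGraph V} {o : V} {x : ℕ → V} {κ : ℝ} {v z : ℕ → V} {lo hi : ℕ → ℝ}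

theorem hi_lt (hM : IsMarkerSequence Γ o x κ v z lo hi) {i : ℕ} {y : V}
    (hy : ∃ᶠ m in atTop, hi i + κ < gromovProduct Γ o y (x m)) :
    hi i < gromovProduct Γ o y (z i) := by
  obtain ⟨m, hm1, hm2⟩ := (hy.and_eventually (hM.reference i)).exists
  rw [gromovProduct_comm] at hm2
  have h1 := hM.four_point y (x m) (z i)
  have h2 : hi i + κ < min (gromovProduct Γ o y (x m)) (gromovProduct Γ o (x m) (z i)) :=
    lt_min hm1 (by linarith [hM.κ_nonneg])
  linarith

theorem hi_lt_of_lt (hM : IsMarkerSequence Γ o x κ v z lo hi) {i j : ℕ} (hij : i < j) :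
    hi i < gromovProduct Γ o (v j) (z i) :=
  hM.hi_lt (hM.ahead i j hij).frequently

theorem eventually_behind (hc : Γ.Connected) (hM : IsMarkerSequence Γ o x κ v z lo hi) (y : V) :
    ∀ᶠ i in atTop, gromovProduct Γ o y (z i) < lo i := by
  filter_upwards [hM.tendsto_lo.eventually_gt_atTop (Γ.dist y o : ℝ)] with i hi
  exact (gromovProduct_le_dist hc o y (z i)).trans_lt hi

theorem eventually_lt_dist (hc : Γ.Connected) (hM : IsMarkerSequence Γ o x κ v z lo hi) (y : V)
    (n : ℕ) : ∀ᶠ i in atTop, n < Γ.dist y (v i) := by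
  filter_upwards [hM.tendsto_lo.eventually_gt_atTop ((n + Γ.dist y o : ℕ) : ℝ)] with i hi
  have h1 := (hM.not_behind i).trans (gromovProduct_le_dist hc o (v i) (z i))
  have h2 : n + Γ.dist y o < Γ.dist (v i) o := by exact_mod_cast hi.trans_le h1
  have h3 := hc.dist_triangle (u := v i) (v := y) (w := o)
  rw [Γ.dist_comm (u := v i) (v := y)] at h3
  omega

/-- A sequence which is eventually not behind arbitrarily far markers converges to the boundary point
of the sequence `x`. -/
theorem convergesToInfinity_and_seqEquiv (hM : IsMarkerSequence Γ o x κ v z lo hi) {y : ℕ → V}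
    (hy : ∀ K : ℝ, ∃ i, K ≤ lo i ∧ ∀ᶠ n in atTop, lo i ≤ gromovProduct Γ o (y n) (z i)) :
    ConvergesToInfinity Γ o y ∧ SeqEquiv Γ o x y := by
  constructor
  · refine tendsto_atTop.2 fun K => ?_
    obtain ⟨i, hi, hev⟩ := hy (K + κ)
    filter_upwards [hev.prod_mk hev] with nm hnm
    have h1 := hM.four_point (y nm.1) (z i) (y nm.2)
    rw [gromovProduct_comm o (z i)] at h1
    have h2 := le_min hnm.1 hnm.2
    linarith
  · refine tendsto_atTop.2 fun K => ?_
    obtain ⟨i, hi, hev⟩ := hy (K + κ)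
    filter_upwards [hev, hM.reference i] with n hn hm
    have h1 := hM.four_point (x n) (z i) (y n)
    rw [gromovProduct_comm o (x n) (z i), gromovProduct_comm o (z i) (y n)] at h1
    have h2 : lo i ≤ min (gromovProduct Γ o (z i) (x n)) (gromovProduct Γ o (y n) (z i)) :=
      le_min (by linarith [hM.lo_le_hi i, hM.κ_nonneg]) hn
    linarith

theorem eventually_lt_gromovProduct (hM : IsMarkerSequence Γ o x κ v z lo hi) {y : ℕ → V}
    (h₁ : ConvergesToInfinity Γ o y) (h₂ : SeqEquiv Γ o x y) (K : ℝ) :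
    ∀ᶠ n in atTop, ∀ᶠ m in atTop, K < gromovProduct Γ o (y n) (x m) := by
  have h3 := (tendsto_atTop.1 h₁ (K + κ + 1)).curry
  filter_upwards [h3] with n hn
  filter_upwards [hn, tendsto_atTop.1 h₂ (K + κ + 1)] with m hm1 hm2
  have h4 := hM.four_point (y n) (y m) (x m)
  rw [gromovProduct_comm o (y m) (x m)] at h4
  have h5 := le_min hm1 hm2
  linarith

variable {ω : Config Γ} {γ γ' : ℕ → V}

/-- A ray in the direction of `x` passes through all the cut vertices `v i` with `i` large. -/
theorem eventually_exists_eq (hc : Γ.Connected) (hpos : ∀ e, 0 < ω e)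
    (hM : IsMarkerSequence Γ o x κ v z lo hi) (hγ : IsOmegaGeodesicRay Γ ω γ)
    (hx : ∀ K : ℝ, ∀ᶠ n in atTop, ∀ᶠ m in atTop, K < gromovProduct Γ o (γ n) (x m)) :
    ∀ᶠ i in atTop, IsCut ω o (z i) (v i) (lo i) (hi i) → ∃ j, γ j = v i := by
  obtain ⟨h, hgeo⟩ := hγ
  filter_upwards [hM.eventually_behind hc (γ 0)] with i hi₀ hcut
  obtain ⟨n, hn⟩ := (hx (hi i + κ)).exists
  have hmem := hcut _ _ _ (hgeo 0 n) ((hgeo 0 n).isPath hc hpos) hi₀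
    (by rw [zero_add]; exact hM.hi_lt hn.frequently)
  obtain ⟨j, hj, hjn⟩ := SimpleGraph.Walk.mem_support_iff_exists_getVert.1 hmem
  rw [length_segment] at hjn
  rw [getVert_segment _ _ _ hjn, zero_add] at hj
  exact ⟨j, hj⟩

/-- Two rays with the same starting point and in the same direction coincide: they pass through the
same cut vertices, and `ω`-geodesics between two points are unique. -/
theorem ray_unique (hc : Γ.Connected) (hpos : ∀ e, 0 < ω e)
    (hinj : ∀ (x y : V) (p q : Γ.Walk x y), p.IsPath → q.IsPath →
      omegaLength ω p = omegaLength ω q → p = q)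
    (hM : IsMarkerSequence Γ o x κ v z lo hi)
    (hcut : ∃ᶠ i in atTop, IsCut ω o (z i) (v i) (lo i) (hi i))
    (hγ : IsOmegaGeodesicRay Γ ω γ)
    (hx : ∀ K : ℝ, ∀ᶠ n in atTop, ∀ᶠ m in atTop, K < gromovProduct Γ o (γ n) (x m))
    (hγ' : IsOmegaGeodesicRay Γ ω γ')
    (hx' : ∀ K : ℝ, ∀ᶠ n in atTop, ∀ᶠ m in atTop, K < gromovProduct Γ o (γ' n) (x m))
    (h0 : γ 0 = γ' 0) : γ = γ' := by
  funext t
  obtain ⟨i, hi, h1, h2, hd⟩ := (hcut.and_eventually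
    ((hM.eventually_exists_eq hc hpos hγ hx).and ((hM.eventually_exists_eq hc hpos hγ' hx').and
      (hM.eventually_lt_dist hc (γ 0) t)))).exists
  obtain ⟨j, hj⟩ := h1 hi
  obtain ⟨j', hj'⟩ := h2 hi
  obtain ⟨h, hgeo⟩ := hγ
  obtain ⟨h', hgeo'⟩ := hγ'
  have key : ∀ {a b a' b' : V} (p : Γ.Walk a b) (q : Γ.Walk a' b'), a = a' → b = b' →
      IsOmegaGeodesic ω p → IsOmegaGeodesic ω q → ∀ t, p.getVert t = q.getVert t := by
    rintro a b _ _ p q rfl rfl hp hq t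
    rw [hinj a b p q (hp.isPath hc hpos) (hq.isPath hc hpos) (hp.trans hq.symm)]
  have e := key (segment γ h 0 j) (segment γ' h' 0 j') h0 (by rw [zero_add, zero_add, hj, hj'])
    (hgeo 0 j) (hgeo' 0 j') t
  have hlen : ∀ {γ : ℕ → V} (h : ∀ k, Γ.Adj (γ k) (γ (k + 1))) (j : ℕ),
      Γ.dist (γ 0) (γ j) ≤ j := fun {γ} h j => by
    have := SimpleGraph.dist_le (segment γ h 0 j)
    rwa [length_segment, zero_add] at this
  have l1 := hlen h j
  have l2 := hlen h' j'
  rw [hj] at l1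
  rw [hj', ← h0] at l2
  rwa [getVert_segment _ _ _ (by omega), getVert_segment _ _ _ (by omega), zero_add] at e

/-- Coalescence: two rays in the same direction pass through a common cut vertex, and coincide
from there on. -/
theorem coalesce (hc : Γ.Connected) (hpos : ∀ e, 0 < ω e)
    (hinj : ∀ (x y : V) (p q : Γ.Walk x y), p.IsPath → q.IsPath →
      omegaLength ω p = omegaLength ω q → p = q)
    (hM : IsMarkerSequence Γ o x κ v z lo hi)
    (hcut : ∃ᶠ i in atTop, IsCut ω o (z i) (v i) (lo i) (hi i))
    (hγ : IsOmegaGeodesicRay Γ ω γ)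
    (hx : ∀ K : ℝ, ∀ᶠ n in atTop, ∀ᶠ m in atTop, K < gromovProduct Γ o (γ n) (x m))
    (hγ' : IsOmegaGeodesicRay Γ ω γ')
    (hx' : ∀ K : ℝ, ∀ᶠ n in atTop, ∀ᶠ m in atTop, K < gromovProduct Γ o (γ' n) (x m)) :
    Coalesce γ γ' := by
  obtain ⟨i, hi, h1, h2⟩ := (hcut.and_eventually
    ((hM.eventually_exists_eq hc hpos hγ hx).and
      (hM.eventually_exists_eq hc hpos hγ' hx'))).exists
  obtain ⟨j, hj⟩ := h1 hi
  obtain ⟨j', hj'⟩ := h2 hi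
  have hshift : ∀ k : ℕ, Tendsto (fun n : ℕ => k + n) atTop atTop := fun k =>
    tendsto_atTop_mono (fun n => Nat.le_add_left n k) tendsto_id
  have hxj : ∀ K : ℝ, ∀ᶠ n in atTop, ∀ᶠ m in atTop, K < gromovProduct Γ o (γ (j + n)) (x m) :=
    fun K => (hshift j).eventually (p := fun n => ∀ᶠ m in atTop, K < gromovProduct Γ o (γ n) (x m))
      (hx K)
  have hxj' : ∀ K : ℝ, ∀ᶠ n in atTop, ∀ᶠ m in atTop, K < gromovProduct Γ o (γ' (j' + n)) (x m) :=
    fun K => (hshift j').eventually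
      (p := fun n => ∀ᶠ m in atTop, K < gromovProduct Γ o (γ' n) (x m)) (hx' K)
  have e : (fun k => γ (j + k)) = fun k => γ' (j' + k) :=
    ray_unique (γ := fun k => γ (j + k)) (γ' := fun k => γ' (j' + k)) hc hpos hinj hM hcut
      (hγ.shift j) hxj (hγ'.shift j') hxj' (by rw [add_zero, add_zero, hj, hj'])
  exact ⟨j, j', fun k => congrFun e k⟩

/-- The `ω`-geodesics from `x₀` to the cut vertices are initial segments of each other, and their
union is a ray. After passing a cut vertex, the ray is never again behind it, since otherwise it
would pass through it a second time. -/
theorem exists_ray (hc : Γ.Connected) (hpos : ∀ e, 0 < ω e)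
    (hinj : ∀ (x y : V) (p q : Γ.Walk x y), p.IsPath → q.IsPath →
      omegaLength ω p = omegaLength ω q → p = q)
    (hex : ∀ x y : V, ∃ p : Γ.Walk x y, IsOmegaGeodesic ω p)
    (hM : IsMarkerSequence Γ o x κ v z lo hi)
    (hcut : ∃ᶠ i in atTop, IsCut ω o (z i) (v i) (lo i) (hi i)) (x₀ : V) :
    ∃ γ : ℕ → V, IsOmegaGeodesicRay Γ ω γ ∧ γ 0 = x₀ ∧
      ∀ K : ℝ, ∃ i, K ≤ lo i ∧ ∃ j₀, ∀ j ≥ j₀, lo i ≤ gromovProduct Γ o (γ j) (z i) := by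
  classical
  obtain ⟨φ, hφ, hφP⟩ := extraction_forall_of_frequently
    (P := fun n i => IsCut ω o (z i) (v i) (lo i) (hi i) ∧ gromovProduct Γ o x₀ (z i) < lo i ∧
      n < Γ.dist x₀ (v i)) fun n => hcut.and_eventually
        ((hM.eventually_behind hc x₀).and (hM.eventually_lt_dist hc x₀ n))
  choose σ hσ using fun n => hex x₀ (v (φ n))
  have hσp : ∀ n, (σ n).IsPath := fun n => (hσ n).isPath hc hpos
  have hlen : ∀ n, n < (σ n).length := fun n =>
    (hφP n).2.2.trans_le (SimpleGraph.dist_le (σ n))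
  have hpre : ∀ a b, a ≤ b → ∀ t ≤ (σ a).length, (σ b).getVert t = (σ a).getVert t := by
    intro a b hab t ht
    rcases hab.eq_or_lt with rfl | hab
    · rfl
    · have hmem : v (φ a) ∈ (σ b).support :=
        (hφP a).1 _ _ _ (hσ b) (hσp b) (hφP a).2.1 (hM.hi_lt_of_lt (hφ hab))
      have hgeo : IsOmegaGeodesic ω ((σ b).takeUntil _ hmem) := by
        refine IsOmegaGeodesic.of_append_left (q := (σ b).dropUntil _ hmem) hc ?_
        rw [SimpleGraph.Walk.take_spec]
        exact hσ b
      have e := hinj _ _ _ _ (hgeo.isPath hc hpos) (hσp a) (hgeo.trans (hσ a).symm)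
      rw [← e] at ht ⊢
      exact (SimpleGraph.Walk.getVert_takeUntil hmem ht).symm
  have hγ : ∀ t b, t ≤ b → (σ t).getVert t = (σ b).getVert t := fun t b htb =>
    (hpre t b htb t (hlen t).le).symm
  have hadj : ∀ k, Γ.Adj ((σ k).getVert k) ((σ (k + 1)).getVert (k + 1)) := fun k => by
    rw [hγ k (k + 1) (Nat.le_succ k)]
    exact (σ (k + 1)).adj_getVert_succ ((Nat.lt_succ_self k).trans (hlen (k + 1)))
  refine ⟨fun t => (σ t).getVert t, ⟨hadj, fun i n => ?_⟩, (σ 0).getVert_zero, fun K => ?_⟩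
  · have h1 := hlen (i + n)
    have hgeo : IsOmegaGeodesic ω (((σ (i + n)).drop i).take n) := by
      refine IsOmegaGeodesic.of_append_left (q := ((σ (i + n)).drop i).drop n) hc ?_
      rw [SimpleGraph.Walk.append_take_drop_eq]
      refine IsOmegaGeodesic.of_append_right (p := (σ (i + n)).take i) hc ?_
      rw [SimpleGraph.Walk.append_take_drop_eq]
      exact hσ (i + n)
    have hl : (((σ (i + n)).drop i).take n).length = n := by
      rw [SimpleGraph.Walk.take_length, SimpleGraph.Walk.drop_length]
      omega
    refine hgeo.congr (by rw [hl, length_segment]) fun t ht => ?_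
    rw [hl] at ht
    rw [getVert_segment _ _ _ ht, SimpleGraph.Walk.take_getVert, SimpleGraph.Walk.drop_getVert,
      min_eq_right ht]
    exact (hγ (i + t) (i + n) (by omega)).symm
  · obtain ⟨a, ha⟩ := ((hM.tendsto_lo.comp hφ.tendsto_atTop).eventually_ge_atTop K).exists
    refine ⟨φ a, ha, (σ a).length, fun j hj => ?_⟩
    by_contra hcon
    push Not at hcon
    have hend : ∀ b, a ≤ b → (σ b).getVert (σ a).length = v (φ a) := fun b hab => by
      rw [hpre a b hab _ le_rfl, SimpleGraph.Walk.getVert_length]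
    rw [hγ j (max j (a + 1)) (le_max_left _ _)] at hcon
    have hab : a < max j (a + 1) := lt_of_lt_of_le (Nat.lt_succ_self a) (le_max_right _ _)
    have hjl : j < (σ (max j (a + 1))).length := (le_max_left _ _).trans_lt (hlen _)
    generalize max j (a + 1) = b at *
    rcases hj.eq_or_lt with hj | hj
    · rw [← hj, hend b hab.le] at hcon
      exact absurd (hM.not_behind (φ a)) (not_le.2 hcon)
    · have hgeo : IsOmegaGeodesic ω ((σ b).drop j) := by
        refine IsOmegaGeodesic.of_append_right (p := (σ b).take j) hc ?_
        rw [SimpleGraph.Walk.append_take_drop_eq]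
        exact hσ b
      have hmem := (hφP a).1 _ _ _ hgeo (hgeo.isPath hc hpos) hcon (hM.hi_lt_of_lt (hφ hab))
      obtain ⟨t, ht, htl⟩ := SimpleGraph.Walk.mem_support_iff_exists_getVert.1 hmem
      rw [SimpleGraph.Walk.drop_getVert, ← hend b hab.le] at ht
      rw [SimpleGraph.Walk.drop_length] at htl
      have := (hσp b).getVert_injOn (show j + t ≤ (σ b).length by omega)
        (show (σ a).length ≤ (σ b).length by omega) ht
      omega

end IsMarkerSequence

/-! ### Markers along the way to a boundary point -/

section Markers

variable {V : Type*} {Γ : SimpleGraph V}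

/-- A distribution without atoms charges two disjoint compact intervals of `(0, ∞)`. -/
theorem exists_two_intervals {ρ : Measure ℝ≥0} [IsProbabilityMeasure ρ]
    (hatoms : ∀ t : ℝ≥0, ρ {t} = 0) :
    ∃ a₀ a₁ b₀ b₁ : ℝ≥0, 0 < a₀ ∧ a₀ ≤ a₁ ∧ a₁ < b₀ ∧ b₀ ≤ b₁ ∧
      ρ (Set.Icc a₀ a₁) ≠ 0 ∧ ρ (Set.Icc b₀ b₁) ≠ 0 := by
  have hex : ∀ F : Finset ℝ≥0, ∃ t ∉ F, ∀ U ∈ nhds t, ρ U ≠ 0 := by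
    intro F
    by_contra hcon
    push Not at hcon
    have h1 : ρ (F : Set ℝ≥0)ᶜ = 0 := measure_null_of_locally_null _ fun t ht => by
      obtain ⟨U, hU, h0⟩ := hcon t ht
      exact ⟨U, mem_nhdsWithin_of_mem_nhds hU, h0⟩
    have h2 : ρ (F : Set ℝ≥0) = 0 := by
      rw [← Set.biUnion_of_singleton (F : Set ℝ≥0)]
      exact (measure_biUnion_null_iff F.countable_toSet).2 fun t _ => hatoms t
    have h3 : ρ Set.univ = 0 := by
      rw [← Set.union_compl_self (F : Set ℝ≥0)]
      exact measure_union_null h2 h1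
    simp at h3
  have key : ∀ t u : ℝ≥0, 0 < t → t < u → (∀ U ∈ nhds t, ρ U ≠ 0) → (∀ U ∈ nhds u, ρ U ≠ 0) →
      ∃ a₀ a₁ b₀ b₁ : ℝ≥0, 0 < a₀ ∧ a₀ ≤ a₁ ∧ a₁ < b₀ ∧ b₀ ≤ b₁ ∧
        ρ (Set.Icc a₀ a₁) ≠ 0 ∧ ρ (Set.Icc b₀ b₁) ≠ 0 := by
    intro t u ht htu hρt hρu
    obtain ⟨a₀, ha₀, ha₀t⟩ := exists_between ht
    obtain ⟨a₁, hta₁, ha₁u⟩ := exists_between htu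
    obtain ⟨b₀, hb₀, hb₀u⟩ := exists_between ha₁u
    exact ⟨a₀, a₁, b₀, u + 1, ha₀, (ha₀t.trans hta₁).le, hb₀,
      hb₀u.le.trans le_self_add, hρt _ (Icc_mem_nhds ha₀t hta₁),
      hρu _ (Icc_mem_nhds hb₀u (lt_add_one u))⟩
  obtain ⟨t, ht0, ht⟩ := hex {0}
  obtain ⟨u, hu0, hu⟩ := hex {0, t}
  simp only [Finset.mem_singleton, Finset.mem_insert, not_or] at ht0 hu0
  rcases lt_or_gt_of_ne hu0.2 with h | h
  · exact key u t (pos_iff_ne_zero.2 hu0.1) h hu ht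
  · exact key t u (pos_iff_ne_zero.2 ht0) h ht hu

/-- The distance to the base point of the `i`-th marker. Consecutive distances are so far apart that
the balls of radius `i + T` around the markers are disjoint. -/
def markerDist (T i : ℕ) : ℕ :=
  2 * (i + T) ^ 2

theorem markerDist_lt {T i j : ℕ} (hT : 0 < T) (hij : i < j) :
    markerDist T i + 2 * (i + j + 2 * T) ≤ markerDist T j ∧ i + T ≤ markerDist T i := by
  unfold markerDist
  obtain ⟨k, rfl⟩ := Nat.exists_eq_add_of_lt hij
  constructor <;> nlinarith

/-- Word geodesic segments of length `2 * N`, on word geodesics from `o` to far away points of the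
sequence `x`; their midpoints are markers in the direction of `x`. -/
theorem exists_isMarkerSequence (hc : Γ.Connected) {δ : ℕ} (hs : IsSlim Γ δ) {o : V} {x : ℕ → V}
    (hx : ConvergesToInfinity Γ o x) {N T : ℕ} (hT : N + 10 * δ + 10 ≤ T) :
    ∃ (s : ℕ → ℕ → V) (z : ℕ → V), (∀ i, IsGeodesicSegment Γ (2 * N) (s i)) ∧
      (∀ i, ∀ j ≤ 2 * N, Between Γ o (s i j) (z i) ∧
        Γ.dist o (s i j) + N = markerDist T i + j) ∧
      IsMarkerSequence Γ o x (4 * δ + 2) (fun i => s i N) z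
        (fun i => (markerDist T i : ℝ) - N - 2 * δ) (fun i => (markerDist T i : ℝ) + N + δ) := by
  have hT0 : 0 < T := by omega
  have hz : ∀ i, ∃ z : V, ∀ᶠ m in atTop,
      (markerDist T i : ℝ) + N + δ + 2 * (4 * δ + 2) < gromovProduct Γ o z (x m) := by
    intro i
    obtain ⟨n, hn⟩ := ((tendsto_atTop.1 hx
      ((markerDist T i : ℝ) + N + δ + 2 * (4 * δ + 2) + 1)).curry).exists
    exact ⟨x n, hn.mono fun m hm => by linarith⟩
  choose z hz using hz
  have hδ : (0 : ℝ) ≤ δ := Nat.cast_nonneg _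
  have hN : (0 : ℝ) ≤ N := Nat.cast_nonneg _
  have hlen : ∀ i, markerDist T i + N ≤ Γ.dist o (z i) := fun i => by
    obtain ⟨m, hm⟩ := (hz i).exists
    have h1 := gromovProduct_le_dist hc o (z i) (x m)
    rw [SimpleGraph.dist_comm] at h1
    have : ((markerDist T i + N : ℕ) : ℝ) ≤ Γ.dist o (z i) := by push_cast; linarith
    exact_mod_cast this
  have hk : ∀ i, N + i + 10 * δ ≤ markerDist T i := fun i => by
    have := (markerDist_lt hT0 (Nat.lt_succ_self i)).2
    omega
  choose g hg hg0 hg1 using fun i => exists_isGeodesicSegment hc o (z i)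
  have hbt : ∀ i, ∀ j ≤ 2 * N, Between Γ o (g i (markerDist T i - N + j)) (z i) ∧
      Γ.dist o (g i (markerDist T i - N + j)) + N = markerDist T i + j := by
    intro i j hj
    have h1 := hlen i
    have h2 := hk i
    have h3 := (hg i).between (Nat.zero_le _)
      (show markerDist T i - N + j ≤ Γ.dist o (z i) by omega) le_rfl
    have h4 := hg i 0 (markerDist T i - N + j) (Nat.zero_le _) (by omega)
    rw [hg0, hg1] at h3
    rw [hg0] at h4
    exact ⟨h3, by omega⟩
  refine ⟨fun i j => g i (markerDist T i - N + j), z, fun i a b hab hb => ?_, hbt, ?_⟩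
  · have h1 := hlen i
    have h2 := hk i
    have := hg i (markerDist T i - N + a) (markerDist T i - N + b) (by omega) (by omega)
    dsimp only
    omega
  have hprod : ∀ i, (markerDist T i : ℝ) ≤
      gromovProduct Γ o (g i (markerDist T i - N + N)) (z i) := by
    intro i
    obtain ⟨h1, h2⟩ := hbt i N (by omega)
    have h3 : (Γ.dist o (g i (markerDist T i - N + N)) : ℝ) +
      Γ.dist (g i (markerDist T i - N + N)) (z i) = Γ.dist o (z i) := by exact_mod_cast h1
    have h4 : (Γ.dist o (g i (markerDist T i - N + N)) : ℝ) = markerDist T i := by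
      have : Γ.dist o (g i (markerDist T i - N + N)) = markerDist T i := by omega
      exact_mod_cast this
    unfold gromovProduct
    rw [Γ.dist_comm (v := o), Γ.dist_comm (u := z i) (v := o)]
    linarith
  refine ⟨fun a b c => hs.min_gromovProduct_le hc o a b c, fun i => by linarith, hz, ?_,
    fun i => by have := hprod i; dsimp only; linarith, ?_, by positivity⟩
  · intro i j hij
    filter_upwards [hz j] with m hm
    have h1 := hs.min_gromovProduct_le hc o (g j (markerDist T j - N + N)) (z j) (x m)
    have h2 := hprod j
    have h3 : (markerDist T i : ℝ) + 2 * (i + j + 2 * T) ≤ markerDist T j := by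
      exact_mod_cast (markerDist_lt hT0 hij).1
    have h4 : (N : ℝ) + 10 * δ + 10 ≤ T := by exact_mod_cast hT
    have h5 : (markerDist T j : ℝ) ≤ min (gromovProduct Γ o (g j (markerDist T j - N + N)) (z j))
        (gromovProduct Γ o (z j) (x m)) := le_min h2 (by linarith)
    have h6 : (0 : ℝ) ≤ i := Nat.cast_nonneg _
    have h7 : (0 : ℝ) ≤ j := Nat.cast_nonneg _
    linarith
  · refine tendsto_atTop_mono (fun i => ?_) tendsto_natCast_atTop_atTop
    have : (N : ℝ) + i + 10 * δ ≤ markerDist T i := by exact_mod_cast hk i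
    linarith

end Markers

/-! ### Geodesic rays in hyperbolic graphs of bounded degree -/

section Rays

variable {V : Type*} {Γ : SimpleGraph V}

/-- Existence and uniqueness of the `ω`-geodesic rays in a given direction, and their coalescence,
as soon as infinitely many markers in this direction are cut vertices. -/
theorem IsMarkerSequence.existsUnique_ray_and_coalesce {o : V} {x : ℕ → V} {κ : ℝ}
    {v z : ℕ → V} {lo hi : ℕ → ℝ} {ω : Config Γ} (hc : Γ.Connected) (hpos : ∀ e, 0 < ω e)
    (hinj : ∀ (x y : V) (p q : Γ.Walk x y), p.IsPath → q.IsPath →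
      omegaLength ω p = omegaLength ω q → p = q)
    (hex : ∀ x y : V, ∃ p : Γ.Walk x y, IsOmegaGeodesic ω p)
    (hM : IsMarkerSequence Γ o x κ v z lo hi)
    (hcut : ∃ᶠ i in atTop, IsCut ω o (z i) (v i) (lo i) (hi i)) {ξ : Boundary Γ o}
    (hξ : ξ.1 = {y | ConvergesToInfinity Γ o y ∧ SeqEquiv Γ o x y}) :
    (∀ x₀ : V, ∃! γ : ℕ → V, IsOmegaRayFromTo ω x₀ ξ γ) ∧
      ∀ (o₁ o₂ : V) (γ₁ γ₂ : ℕ → V), IsOmegaRayFromTo ω o₁ ξ γ₁ → IsOmegaRayFromTo ω o₂ ξ γ₂ →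
        Coalesce γ₁ γ₂ := by
  have hmem : ∀ y : ℕ → V, ConvergesTo y ξ ↔ ConvergesToInfinity Γ o y ∧ SeqEquiv Γ o x y :=
    fun y => by rw [ConvergesTo, hξ]; rfl
  have hdir : ∀ {x₀ : V} {γ : ℕ → V}, IsOmegaRayFromTo ω x₀ ξ γ →
      ∀ K : ℝ, ∀ᶠ n in atTop, ∀ᶠ m in atTop, K < gromovProduct Γ o (γ n) (x m) := fun hγ => by
    have := (hmem _).1 hγ.2.2.1
    exact hM.eventually_lt_gromovProduct this.1 this.2
  refine ⟨fun x₀ => ?_, fun o₁ o₂ γ₁ γ₂ h₁ h₂ =>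
    hM.coalesce hc hpos hinj hcut h₁.1 (hdir h₁) h₂.1 (hdir h₂)⟩
  obtain ⟨γ, hγ, hγ0, hγlo⟩ := hM.exists_ray hc hpos hinj hex hcut x₀
  have hray : IsOmegaRayFromTo ω x₀ ξ γ := by
    refine ⟨hγ, hγ0, (hmem _).2 (hM.convergesToInfinity_and_seqEquiv fun K => ?_), fun y hy hd =>
      (hmem _).2 (hM.convergesToInfinity_and_seqEquiv fun K => ?_)⟩
    · obtain ⟨i, hi, j₀, hj⟩ := hγlo K
      exact ⟨i, hi, eventually_atTop.2 ⟨j₀, hj⟩⟩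
    · obtain ⟨i, hi, j₀, hj⟩ := hγlo K
      refine ⟨i, hi, ?_⟩
      obtain ⟨h, -⟩ := hγ
      filter_upwards [hd.eventually_gt_atTop (j₀ + Γ.dist (γ 0) o)] with n hn
      obtain ⟨j, hjn⟩ := hy n
      rw [← hjn] at hn ⊢
      refine hj j ?_
      have h1 := SimpleGraph.dist_le (segment γ h 0 j)
      rw [length_segment, zero_add] at h1
      have h2 := hc.dist_triangle (u := γ j) (v := γ 0) (w := o)
      rw [Γ.dist_comm (u := γ j) (v := γ 0)] at h2
      omega
  exact ⟨γ, hray, fun γ' hγ' => hM.ray_unique hc hpos hinj hcut hγ'.1 (hdir hγ') hγ (hdir hray)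
    (hγ'.2.1.trans hγ0.symm)⟩

/-- A corridor of cheap edges around a marker makes it a cut vertex. -/
theorem HasCorridor.isCut {ω : Config Γ} {δ : ℕ} {a₀ a₁ b₀ b₁ : ℝ≥0} {c B R : ℝ} {N M H k : ℕ}
    {s : ℕ → V} {o z : V} (hc : Γ.Connected) (hslim : IsSlim Γ δ)
    (hs : IsGeodesicSegment Γ (2 * N) s)
    (hsz : ∀ j ≤ 2 * N, Between Γ o (s j) z ∧ Γ.dist o (s j) + N = k + j)
    (hcor : HasCorridor ω a₀ a₁ b₀ b₁ N M s) (hab : a₁ < b₀) (hb : b₀ ≤ b₁) (hB : 0 ≤ B)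
    (hgrow : HasLinearGrowth ω c B R (s N))
    (hk : ((b₀ : ℝ) + b₁) * (2 * (H + 2 * δ : ℕ)) < (b₀ - a₁) * N) (hkN : H + 2 * δ ≤ N)
    (hH : ∀ h > H, ∃ m : ℕ, m * δ < h ∧
      ∀ n : ℕ, c * n ≤ B * (12 * h) + 2 * (R + (10 * h + (N + 2 * δ : ℕ))) → n + 4 * h ≤ 2 ^ m)
    (hM : ∀ n : ℕ, c * n ≤ B * (4 * N) + 2 * (R + 2 * N) → n + 3 * N ≤ M) :
    IsCut ω o z (s N) ((k : ℝ) - N - 2 * δ) ((k : ℝ) + N + δ) := by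
  intro x y σ hσ hpath hx hy
  have hN : (0 : ℝ) ≤ N := Nat.cast_nonneg _
  obtain ⟨h1, h2⟩ := hsz 0 (Nat.zero_le _)
  obtain ⟨h3, h4⟩ := hsz (2 * N) le_rfl
  have h2' : (Γ.dist o (s 0) : ℝ) + N = k := by exact_mod_cast h2
  have h4' : (Γ.dist o (s (2 * N)) : ℝ) + N = k + 2 * N := by exact_mod_cast h4
  exact hcor.mem_support hc hslim hs hab hb hB hgrow hk hkN hH hM hσ hpath
    (hslim.exists_between_dist_le hc h1 (by linarith) (by linarith))
    (hslim.exists_between_dist_le hc h3 (by linarith) (by linarith))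

/-- Almost surely, there is a unique `ω`-geodesic ray from every vertex in a given direction, and any
two rays in this direction coalesce. -/
theorem ae_existsUnique_ray_and_coalesce [Γ.LocallyFinite] (hc : Γ.Connected) {D : ℕ}
    (hD : ∀ v, Γ.degree v ≤ D) (hhyp : IsHyperbolic Γ) {ρ : Measure ℝ≥0} [IsProbabilityMeasure ρ]
    (hatoms : ∀ t : ℝ≥0, ρ {t} = 0)
    (hsubG : ∃ a : ℝ, 0 < a ∧ Integrable (fun t : ℝ≥0 => Real.exp (a * (t : ℝ) ^ 2)) ρ)
    {o : V} (ξ : Boundary Γ o) :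
    ∀ᵐ ω ∂(configMeasure Γ ρ), (∀ x₀ : V, ∃! γ : ℕ → V, IsOmegaRayFromTo ω x₀ ξ γ) ∧
      ∀ (o₁ o₂ : V) (γ₁ γ₂ : ℕ → V), IsOmegaRayFromTo ω o₁ ξ γ₁ → IsOmegaRayFromTo ω o₂ ξ γ₂ →
        Coalesce γ₁ γ₂ := by
  obtain ⟨δ', -, hδ'⟩ := hhyp
  have hslim := hδ'.isSlim hc
  generalize ⌈δ'⌉₊ + 1 = δ at hslim
  obtain ⟨x, hx, hξ⟩ := ξ.2
  obtain ⟨a₀, a₁, b₀, b₁, ha₀, ha, hab, hb, hρa, hρb⟩ := exists_two_intervals hatoms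
  obtain ⟨l, c, B, hrate⟩ := exists_isGrowthRate (hatoms 0) hsubG D b₁ ha₀
  obtain ⟨R, hR⟩ : ∃ R : ℝ, ENNReal.ofReal (Real.exp (-(l * R))) * 8 ≤ 2⁻¹ := by
    have h1 : Tendsto (fun R : ℝ => ENNReal.ofReal (Real.exp (-(l * R))) * 8) atTop
        (nhds (ENNReal.ofReal 0 * 8)) :=
      ENNReal.Tendsto.mul_const (ENNReal.tendsto_ofReal (Real.tendsto_exp_atBot.comp
        (tendsto_neg_atTop_atBot.comp (tendsto_id.const_mul_atTop hrate.l_pos)))) (Or.inr (by simp))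
    rw [ENNReal.ofReal_zero, zero_mul] at h1
    exact (h1.eventually_lt_const (show (0 : ℝ≥0∞) < 2⁻¹ by simp)).exists.imp fun R h => h.le
  have hab' : (0 : ℝ) < b₀ - a₁ := sub_pos.2 (by exact_mod_cast hab)
  have hb' : (0 : ℝ) < b₀ + b₁ := by
    have h1 : (0 : ℝ) ≤ a₁ := a₁.2
    have h2 : (0 : ℝ) ≤ b₁ := b₁.2
    linarith
  obtain ⟨N, H, hHN, hkN, hH⟩ := exists_corridor_scale δ (B := B) (R := R) (c := c)
    (κ := (b₀ - a₁) / (2 * (b₀ + b₁))) hrate.c_pos (by positivity)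
  have hk : ((b₀ : ℝ) + b₁) * (2 * (H + 2 * δ : ℕ)) < (b₀ - a₁) * N := by
    rw [div_mul_eq_mul_div, lt_div_iff₀ (by positivity)] at hHN
    linarith
  obtain ⟨M, hM⟩ : ∃ M : ℕ, ∀ n : ℕ, c * n ≤ B * (4 * N) + 2 * (R + 2 * N) → n + 3 * N ≤ M := by
    refine ⟨⌈(B * (4 * N) + 2 * (R + 2 * N)) / c⌉₊ + 3 * N, fun n hn => ?_⟩
    have h1 : (n : ℝ) ≤ (B * (4 * N) + 2 * (R + 2 * N)) / c := by
      rw [le_div_iff₀ hrate.c_pos]; linarith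
    have h2 : n ≤ ⌈(B * (4 * N) + 2 * (R + 2 * N)) / c⌉₊ := by
      exact_mod_cast h1.trans (Nat.le_ceil _)
    omega
  obtain ⟨s, z, hs, hsz, hmark⟩ := exists_isMarkerSequence hc hslim hx
    (N := N) (T := M + N + 10 * δ + 10) (by omega)
  have hsep : ∀ i j, i ≠ j → (i + (M + N + 10 * δ + 10)) + (j + (M + N + 10 * δ + 10)) <
      Γ.dist (s i N) (s j N) := by
    have hlt : ∀ i j, i < j → (i + (M + N + 10 * δ + 10)) + (j + (M + N + 10 * δ + 10)) <
        Γ.dist (s i N) (s j N) := by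
      intro i j hij
      have h1 := (markerDist_lt (T := M + N + 10 * δ + 10) (by omega) hij).1
      have h2 := (hsz i N (by omega)).2
      have h3 := (hsz j N (by omega)).2
      have h4 := hc.dist_triangle (u := o) (v := s i N) (w := s j N)
      omega
    intro i j hij
    rcases lt_or_gt_of_ne hij with h | h
    · exact hlt i j h
    · rw [SimpleGraph.dist_comm]
      have := hlt j i h
      omega
  filter_upwards [ae_frequently_hasCorridor hc hD hrate ha hab hb hρa hρb hR (N := N) (M := M)
    (s := s) (T := fun i => i + (M + N + 10 * δ + 10)) (fun i => by omega)
    (fun i => by omega) hsep,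
    ae_injective_omegaLength hc hatoms, ae_weight_pos hc (hatoms 0)] with ω hcor hinj hpos
  obtain ⟨i, -, hgrow⟩ := hcor.exists
  exact hmark.existsUnique_ray_and_coalesce hc hpos hinj
    (hgrow.exists_isOmegaGeodesic hc hrate.c_pos) (hcor.mono fun i hi =>
      hi.1.isCut hc hslim (hs i) (hsz i) hab hb hrate.B_nonneg hi.2 hk hkN hH hM) hξ

end Rays

/-! ### Cayley graphs -/

section Cayley

variable {G : Type*} [Group G] {S : Set G}

theorem connected_mulCayley (hgen : Subgroup.closure S = ⊤) :
    (SimpleGraph.mulCayley S).Connected := by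
  have hstep : ∀ a : G, ∀ g ∈ S, (SimpleGraph.mulCayley S).Reachable a (a * g) := by
    intro a g hg
    by_cases h : a = a * g
    · rw [← h]
    · exact SimpleGraph.Adj.reachable
        ((SimpleGraph.mulCayley_adj' S _ _).2 ⟨h, g, hg, Or.inl rfl⟩)
  have hone : ∀ b : G, ∀ a : G, (SimpleGraph.mulCayley S).Reachable a (a * b) := by
    intro b
    have hb : b ∈ Subgroup.closure S := by rw [hgen]; trivial
    induction hb using Subgroup.closure_induction with
    | mem g hg => exact fun a => hstep a g hg
    | one =>
      intro a
      rw [mul_one]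
    | mul b b' _ _ ih ih' =>
      intro a
      rw [← mul_assoc]
      exact (ih a).trans (ih' (a * b))
    | inv b _ ih =>
      intro a
      have := ih (a * b⁻¹)
      rw [inv_mul_cancel_right] at this
      exact this.symm
  have : Nonempty G := ⟨1⟩
  refine SimpleGraph.Connected.mk fun a b => ?_
  have := hone (a⁻¹ * b) a
  rwa [mul_inv_cancel_left] at this

theorem neighborSet_mulCayley_subset (hsymm : ∀ s ∈ S, s⁻¹ ∈ S) (a : G) :
    (SimpleGraph.mulCayley S).neighborSet a ⊆ (a * ·) '' S := by
  intro b hb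
  obtain ⟨-, g, hg, h | h⟩ := (SimpleGraph.mulCayley_adj' S a b).1 hb
  · exact ⟨g, hg, h⟩
  · exact ⟨g⁻¹, hsymm g hg, by simp [h]⟩

end Cayley

end FPP

theorem theorem7p5 {G : Type*} [Group G] (S : Set G) (hfin : S.Finite)
    (hsymm : ∀ s ∈ S, s⁻¹ ∈ S) (hgen : Subgroup.closure S = ⊤)
    (hhyp : FPP.IsHyperbolic (SimpleGraph.mulCayley S))
    (ρ : Measure ℝ≥0) [IsProbabilityMeasure ρ] (hatoms : ∀ t : ℝ≥0, ρ {t} = 0)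
    (hsubG : ∃ a : ℝ, 0 < a ∧ Integrable (fun t : ℝ≥0 => Real.exp (a * (t : ℝ) ^ 2)) ρ)
    (ξ : FPP.Boundary (SimpleGraph.mulCayley S) (1 : G)) :
    (∀ o : G, ∀ᵐ ω ∂(FPP.configMeasure (SimpleGraph.mulCayley S) ρ),
      ∃! γ : ℕ → G, FPP.IsOmegaRayFromTo ω o ξ γ) ∧
    (∀ᵐ ω ∂(FPP.configMeasure (SimpleGraph.mulCayley S) ρ), ∀ o₁ o₂ : G, ∀ γ₁ γ₂ : ℕ → G,
      FPP.IsOmegaRayFromTo ω o₁ ξ γ₁ → FPP.IsOmegaRayFromTo ω o₂ ξ γ₂ →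
        FPP.Coalesce γ₁ γ₂) := by
  classical
  have hsub := FPP.neighborSet_mulCayley_subset hsymm
  have hfinN : ∀ a, ((SimpleGraph.mulCayley S).neighborSet a).Finite := fun a =>
    (hfin.image _).subset (hsub a)
  let _ : (SimpleGraph.mulCayley S).LocallyFinite := fun a => (hfinN a).fintype
  have hD : ∀ a, (SimpleGraph.mulCayley S).degree a ≤ S.ncard := fun a => by
    rw [← SimpleGraph.card_neighborSet_eq_degree, ← Nat.card_eq_fintype_card,
      Nat.card_coe_set_eq]
    exact (Set.ncard_le_ncard (hsub a) (hfin.image _)).trans (Set.ncard_image_le hfin)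
  have key := FPP.ae_existsUnique_ray_and_coalesce (FPP.connected_mulCayley hgen) hD hhyp hatoms
    hsubG ξ
  exact ⟨fun o => key.mono fun ω hω => hω.1 o, key.mono fun ω hω => hω.2⟩
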